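/- Let $p$ be a prime and let $G$ be a (topologically) finitely generated pro-$p$ group. Let $H^\bullet(G,\mathbb{F}_p)=\bigoplus_{n\ge 0}H^n(G,\mathbb{F}_p)$ denote its continuous cohomology algebra with coefficients in the trivial module $\mathbb{F}_p$, with multiplication given by the cup product. A graded $\mathbb{F}_p$-algebra $A_\bullet=\bigoplus_{n\ge 0}A_n$ is called quadratic if there is an isomorphism of graded algebras $A_\bullet\cong T_\bullet(A_1)/(\Omega)$ for some subset $\Omega\subseteq A_1\otimes A_1$, where $T_\bullet(A_1)$ is the tensor algebra and $(\Omega)$ is the two-sided ideal generated by $\Omega$. A pro-$p$ group $G$ is called $H^\bullet$-quadratic if $H^\bullet(G,\mathbb{F}_p)$ is a quadratic algebra. A group is called $2$-elementary abelian if it is abelian and $g^2=1$ for each of its elements $g$ (the trivial group is included). Then: (a) If $p$ is odd and $G$ is $H^\bullet$-quadratic, then $G$ is torsion-free, i.e. the only element of finite order in $G$ is the identity. (b) If $p=2$ and $G$ is finite and abelian, then $G$ is $H^\bullet$-quadratic if and only if $G$ is $2$-elementary abelian. (c) If $p=2$ and $G$ is finite, then every subgroup of $G$ is $H^\bullet$-quadratic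 if and only if $G$ is $2$-elementary abelian. -/

import Mathlib

open scoped TensorProduct DirectSum

noncomputable section

set_option linter.unusedSectionVars false

/-! ### Continuous cohomology with trivial discrete coefficients, and the cup product -/

namespace TrivCoh

/-- Continuous inhomogeneous `n`-cochains of `G` with values in the discrete ring `k`: a map into
a discrete space is continuous if and only if it is locally constant. -/
abbrev Cochain (k G : Type*) [TopologicalSpace G] (n : ℕ) : Type _ :=
  LocallyConstant (Fin n → G) k

section Complex

variable (k G : Type*) [CommRing k] [Group G] [TopologicalSpace G] [IsTopologicalGroup G]

/-- The map `(x₀, …, xₙ) ↦ (x₁, …, xₙ)`. -/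
def tailMap (n : ℕ) : C(Fin (n + 1) → G, Fin n → G) where
  toFun x := fun i => x i.succ
  continuous_toFun := by fun_prop

/-- The map `(x₀, …, xₙ) ↦ (x₀, …, xⱼ xⱼ₊₁, …, xₙ)`, which for `j = n` drops the last entry. -/
def contractMap (n : ℕ) (j : Fin (n + 1)) : C(Fin (n + 1) → G, Fin n → G) where
  toFun x := Fin.contractNth j (· * ·) x
  continuous_toFun := by
    refine continuous_pi fun i => ?_
    unfold Fin.contractNth
    split_ifs <;> fun_prop

/-- The projection of `(x₀, …, x_{i+j-1})` to the first `i` entries. -/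
def leftMap (i j : ℕ) : C(Fin (i + j) → G, Fin i → G) where
  toFun x := fun a => x (Fin.castAdd j a)
  continuous_toFun := by fun_prop

/-- The projection of `(x₀, …, x_{i+j-1})` to the last `j` entries. -/
def rightMap (i j : ℕ) : C(Fin (i + j) → G, Fin j → G) where
  toFun x := fun b => x (Fin.natAdd i b)
  continuous_toFun := by fun_prop

/-- The differential of the inhomogeneous cochain complex (trivial action on `k`):
`(d f)(x₀, …, xₙ) = f(x₁, …, xₙ) + ∑ⱼ (-1)^(j+1) f(x₀, …, xⱼ xⱼ₊₁, …, xₙ)`, where the term for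
`j = n` is `(-1)^(n+1) f(x₀, …, xₙ₋₁)`. -/
def d (n : ℕ) : Cochain k G n →ₗ[k] Cochain k G (n + 1) :=
  LocallyConstant.comapₗ k (tailMap G n) +
    ∑ j : Fin (n + 1), (-1 : k) ^ ((j : ℕ) + 1) • LocallyConstant.comapₗ k (contractMap G n j)

/-- The continuous `n`-cocycles. -/
def cocycles (n : ℕ) : Submodule k (Cochain k G n) := LinearMap.ker (d k G n)

/-- The continuous `n`-coboundaries. -/
def coboundaries : (n : ℕ) → Submodule k (Cochain k G n)
  | 0 => ⊥
  | n + 1 => LinearMap.range (d k G n)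

/-- The continuous cohomology `Hⁿ(G, k)` with coefficients in the trivial discrete module `k`. -/
def H (n : ℕ) : Type _ := cocycles k G n ⧸ (coboundaries k G n).submoduleOf (cocycles k G n)

instance (n : ℕ) : AddCommGroup (H k G n) :=
  inferInstanceAs (AddCommGroup (_ ⧸ (coboundaries k G n).submoduleOf (cocycles k G n)))

instance (n : ℕ) : Module k (H k G n) :=
  inferInstanceAs (Module k (_ ⧸ (coboundaries k G n).submoduleOf (cocycles k G n)))

/-- The class of a cocycle. -/
def mk (n : ℕ) : cocycles k G n →ₗ[k] H k G n :=
  ((coboundaries k G n).submoduleOf (cocycles k G n)).mkQ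

/-- The cup product of cochains,
`(f ⌣ h)(x₁, …, xᵢ₊ⱼ) = f(x₁, …, xᵢ) * h(xᵢ₊₁, …, xᵢ₊ⱼ)`. -/
def cupCochain (i j : ℕ) : Cochain k G i →ₗ[k] Cochain k G j →ₗ[k] Cochain k G (i + j) :=
  (LinearMap.mul k (Cochain k G (i + j))).compl₁₂
    (LocallyConstant.comapₗ k (leftMap G i j)) (LocallyConstant.comapₗ k (rightMap G i j))

variable {k G}

lemma mk_surjective (n : ℕ) : Function.Surjective (mk k G n) := Submodule.mkQ_surjective _

lemma mk_eq_zero_iff {n : ℕ} (z : cocycles k G n) :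
    mk k G n z = 0 ↔ (z : Cochain k G n) ∈ coboundaries k G n :=
  Submodule.Quotient.mk_eq_zero _

lemma d_apply (n : ℕ) (f : Cochain k G n) (x : Fin (n + 1) → G) :
    d k G n f x = f (fun i => x i.succ) +
      ∑ j : Fin (n + 1), (-1 : k) ^ ((j : ℕ) + 1) * f (Fin.contractNth j (· * ·) x) := by
  have key : ∀ s : Finset (Fin (n + 1)),
      (∑ j ∈ s, (-1 : k) ^ ((j : ℕ) + 1) • LocallyConstant.comap (contractMap G n j) f) x
        = ∑ j ∈ s, (-1 : k) ^ ((j : ℕ) + 1) * f (Fin.contractNth j (· * ·) x) := by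
    intro s
    induction s using Finset.induction_on with
    | empty => simp
    | insert a s ha ih =>
      rw [Finset.sum_insert ha, Finset.sum_insert ha, LocallyConstant.add_apply, ih]
      rfl
  rw [← key Finset.univ]
  simp only [d, LinearMap.add_apply, LinearMap.sum_apply, LinearMap.smul_apply]
  rfl

lemma cupCochain_apply (i j : ℕ) (f : Cochain k G i) (h : Cochain k G j) (x : Fin (i + j) → G) :
    cupCochain k G i j f h x =
      f (fun a => x (Fin.castAdd j a)) * h (fun b => x (Fin.natAdd i b)) := rfl

/-- Reindexing of cochains along an equality of degrees. -/
def castCochain {m n : ℕ} (e : m = n) (f : Cochain k G m) : Cochain k G n := e ▸ f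

lemma castCochain_apply {m n : ℕ} (e : m = n) (f : Cochain k G m) (x : Fin n → G) :
    castCochain e f x = f (fun a => x (Fin.cast e a)) := by
  subst e; rfl

lemma castCochain_mem_coboundaries_iff {m n : ℕ} (e : m = n) {f : Cochain k G m} :
    castCochain e f ∈ coboundaries k G n ↔ f ∈ coboundaries k G m := by
  subst e; rfl

lemma d_cup_apply (i j : ℕ) (f : Cochain k G i) (h : Cochain k G j) (x : Fin (i + j + 1) → G) :
    d k G (i + j) (cupCochain k G i j f h) x =
      d k G i f (fun a => x (Fin.cast (by omega) (Fin.castAdd j a))) *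
          h (fun b => x (Fin.cast (by omega) (Fin.natAdd (i + 1) b))) +
        (-1) ^ i * cupCochain k G i (j + 1) f (d k G j h) x := by
  rw [cupCochain_apply, d_apply, d_apply, d_apply]
  simp only [cupCochain_apply]
  rw [Fin.sum_univ_castSucc (n := i)]
  have hs := Fin.sum_univ_add (a := i) (b := j + 1) (fun l : Fin (i + (j + 1)) =>
    (-1 : k) ^ ((l : ℕ) + 1) *
      (f (fun a => Fin.contractNth (n := i + j) l (· * ·) x (Fin.castAdd j a)) *
        h (fun b => Fin.contractNth (n := i + j) l (· * ·) x (Fin.natAdd i b))))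
  rw [show (∑ l : Fin (i + j + 1), (-1 : k) ^ ((l : ℕ) + 1) *
      (f (fun a => Fin.contractNth (n := i + j) l (· * ·) x (Fin.castAdd j a)) *
        h (fun b => Fin.contractNth (n := i + j) l (· * ·) x (Fin.natAdd i b)))) = _ from hs]
  have e1 : ∀ a : Fin i,
      (fun c => Fin.contractNth (n := i + j) (Fin.castAdd (j + 1) a) (· * ·) x (Fin.castAdd j c))
      = Fin.contractNth a.castSucc (· * ·)
          (fun c => x (Fin.cast (by omega) (Fin.castAdd j c))) := by
    intro a; funext c; simp only [Fin.contractNth]; rfl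
  have e2 : ∀ a : Fin i,
      (fun c => Fin.contractNth (n := i + j) (Fin.castAdd (j + 1) a) (· * ·) x (Fin.natAdd i c))
      = fun c => x (Fin.cast (by omega) (Fin.natAdd (i + 1) c)) := by
    intro a; funext c
    rw [Fin.contractNth_apply_of_gt _ _ _ _ (by simp; omega)]
    congr 1; ext; simp; omega
  have e3 : ∀ b : Fin (j + 1),
      (fun c => Fin.contractNth (n := i + j) (Fin.natAdd i b) (· * ·) x (Fin.castAdd j c))
      = fun c => x (Fin.castAdd (j + 1) c) := by
    intro b; funext c
    rw [Fin.contractNth_apply_of_lt _ _ _ _ (by simp; omega)]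
    rfl
  have e4 : ∀ b : Fin (j + 1),
      (fun c => Fin.contractNth (n := i + j) (Fin.natAdd i b) (· * ·) x (Fin.natAdd i c))
      = Fin.contractNth b (· * ·) (fun c => x (Fin.natAdd i c)) := by
    intro b; funext c
    simp only [Fin.contractNth, Fin.val_natAdd, add_lt_add_iff_left, add_right_inj]
    rfl
  have e5 : Fin.contractNth (Fin.last i) (· * ·)
        (fun c => x (Fin.cast (by omega) (Fin.castAdd j c)))
      = fun c => x (Fin.castAdd (j + 1) c) := by
    funext c
    rw [Fin.contractNth_apply_of_lt _ _ _ _ (by simp)]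
    rfl
  have e6 : (fun b : Fin j => x (Fin.natAdd i b).succ)
      = fun c => x (Fin.cast (by omega) (Fin.natAdd (i + 1) c)) := by
    funext c; congr 1; ext; simp; omega
  have e7 : (fun b : Fin j => x (Fin.natAdd i b.succ))
      = fun c => x (Fin.cast (by omega) (Fin.natAdd (i + 1) c)) := by
    funext c; congr 1; ext; simp; omega
  have e8 : (fun a : Fin i => x (Fin.castAdd j a).succ)
      = fun a : Fin i => x (Fin.cast (by omega) (Fin.castAdd j a.succ)) := by
    funext c; rfl
  simp only [e1, e2, e3, e4, e5, e6, e7, e8, Fin.val_castAdd, Fin.val_natAdd, Fin.val_castSucc,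
    Fin.val_last]
  rw [add_mul, add_mul, Finset.sum_mul, mul_add, mul_add, Finset.mul_sum, Finset.mul_sum]
  have e9 : ∀ b : Fin (j + 1), ∀ u v : k, (-1 : k) ^ (i + (b : ℕ) + 1) * (u * v)
      = (-1) ^ i * (u * ((-1) ^ ((b : ℕ) + 1) * v)) := by
    intro b u v; ring
  simp only [e9]
  simp only [mul_assoc]
  ring

lemma cup_mem_cocycles {i j : ℕ} {f : Cochain k G i} {h : Cochain k G j}
    (hf : f ∈ cocycles k G i) (hh : h ∈ cocycles k G j) :
    cupCochain k G i j f h ∈ cocycles k G (i + j) := by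
  rw [cocycles, LinearMap.mem_ker] at *
  ext x
  rw [d_cup_apply, hf, hh, map_zero]
  simp

lemma cup_mem_coboundaries_left {i j : ℕ} {f : Cochain k G i} {h : Cochain k G j}
    (hf : f ∈ coboundaries k G i) (hh : h ∈ cocycles k G j) :
    cupCochain k G i j f h ∈ coboundaries k G (i + j) := by
  rw [cocycles, LinearMap.mem_ker] at hh
  cases i with
  | zero =>
    obtain rfl : f = 0 := hf
    simp
  | succ i =>
    obtain ⟨g, rfl⟩ := hf
    have e : i + 1 + j = i + j + 1 := by omega
    rw [← castCochain_mem_coboundaries_iff e]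
    refine ⟨cupCochain k G i j g h, ?_⟩
    ext x
    rw [d_cup_apply, hh, map_zero, castCochain_apply, cupCochain_apply]
    simp

lemma cup_mem_coboundaries_right {i j : ℕ} {f : Cochain k G i} {h : Cochain k G j}
    (hf : f ∈ cocycles k G i) (hh : h ∈ coboundaries k G j) :
    cupCochain k G i j f h ∈ coboundaries k G (i + j) := by
  rw [cocycles, LinearMap.mem_ker] at hf
  cases j with
  | zero =>
    obtain rfl : h = 0 := hh
    simp
  | succ j =>
    obtain ⟨g, rfl⟩ := hh
    refine ⟨(-1 : k) ^ i • cupCochain k G i j f g, ?_⟩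
    ext x
    rw [map_smul]
    change (-1 : k) ^ i * d k G (i + j) (cupCochain k G i j f g) x = _
    rw [d_cup_apply, hf, LocallyConstant.coe_zero, Pi.zero_apply, zero_mul, zero_add, ← mul_assoc,
      ← mul_pow, neg_one_mul, neg_neg, one_pow, one_mul]

variable (k G)

/-- The cup product of cocycles. -/
def cupCocycle (i j : ℕ) : cocycles k G i →ₗ[k] cocycles k G j →ₗ[k] cocycles k G (i + j) :=
  LinearMap.mk₂ k (fun z w => ⟨cupCochain k G i j z w, cup_mem_cocycles z.2 w.2⟩)
    (fun _ _ _ => Subtype.ext (by simp)) (fun _ _ _ => Subtype.ext (by simp))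
    (fun _ _ _ => Subtype.ext (by simp)) (fun _ _ _ => Subtype.ext (by simp))

/-- The cup product `Hⁱ(G, k) × Hʲ(G, k) → Hⁱ⁺ʲ(G, k)`, induced by the cup product of cocycles. -/
def cup (i j : ℕ) : H k G i →ₗ[k] H k G j →ₗ[k] H k G (i + j) :=
  Submodule.liftQ _
    (LinearMap.flip (Submodule.liftQ _
      (LinearMap.flip ((cupCocycle k G i j).compr₂ (mk k G (i + j))))
      (fun w hw => by
        ext z
        exact (mk_eq_zero_iff _).2
          (cup_mem_coboundaries_right z.2 hw))))
    (fun z hz => by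
      ext w
      obtain ⟨w, rfl⟩ := mk_surjective _ w
      exact (mk_eq_zero_iff _).2
        (cup_mem_coboundaries_left hz w.2))

variable {k G}

lemma cup_mk (i j : ℕ) (z : cocycles k G i) (w : cocycles k G j) :
    cup k G i j (mk k G i z) (mk k G j w) = mk k G (i + j) (cupCocycle k G i j z w) := rfl

lemma const_mem_cocycles (r : k) :
    (LocallyConstant.const _ r : Cochain k G 0) ∈ cocycles k G 0 := by
  rw [cocycles, LinearMap.mem_ker]
  ext x
  rw [d_apply]
  simp

variable (k G)

/-- The structure map `k → H⁰(G, k)`, `r ↦ ` the class of the constant cochain `r`. -/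
def unit : k →+ H k G 0 where
  toFun r := mk k G 0 ⟨LocallyConstant.const _ r, const_mem_cocycles r⟩
  map_zero' := (mk k G 0).map_zero
  map_add' r s := by
    rw [← map_add]; rfl

variable {k G}

lemma gradedMonoid_eq {m n : ℕ} (e : m = n) (z : cocycles k G m) (w : cocycles k G n)
    (hzw : ∀ x : Fin n → G, (z : Cochain k G m) (fun a => x (Fin.cast e a)) = w.1 x) :
    (GradedMonoid.mk m (mk k G m z) : GradedMonoid (H k G)) = GradedMonoid.mk n (mk k G n w) := by
  subst e
  obtain rfl : z = w := Subtype.ext (LocallyConstant.ext hzw)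
  rfl

instance gMul : GradedMonoid.GMul (H k G) where
  mul {i j} a b := cup k G i j a b

instance gOne : GradedMonoid.GOne (H k G) where
  one := unit k G 1

/-- The graded ring structure on `H^•(G, k)` given by the cup product. -/
instance gSemiring : DirectSum.GSemiring (H k G) where
  mul_zero _ := map_zero _
  zero_mul _ := LinearMap.map_zero₂ _ _
  mul_add _ _ _ := map_add _ _ _
  add_mul _ _ _ := LinearMap.map_add₂ _ _ _ _
  one_mul := by
    rintro ⟨n, a⟩
    obtain ⟨z, rfl⟩ := mk_surjective n a
    refine gradedMonoid_eq (k := k) (G := G) (zero_add n) (cupCocycle k G 0 n _ z) z fun x => ?_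
    change 1 * z.1 (fun b => x (Fin.cast (zero_add n) (Fin.natAdd 0 b))) = z.1 x
    rw [one_mul]
    congr 1; funext b; congr 1; ext; simp
  mul_one := by
    rintro ⟨n, a⟩
    obtain ⟨z, rfl⟩ := mk_surjective n a
    refine gradedMonoid_eq (k := k) (G := G) (add_zero n) (cupCocycle k G n 0 z _) z fun x => ?_
    change z.1 x * 1 = z.1 x
    rw [mul_one]
  mul_assoc := by
    rintro ⟨l, a⟩ ⟨m, b⟩ ⟨n, c⟩
    obtain ⟨u, rfl⟩ := mk_surjective l a
    obtain ⟨v, rfl⟩ := mk_surjective m b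
    obtain ⟨w, rfl⟩ := mk_surjective n c
    refine gradedMonoid_eq (k := k) (G := G) (add_assoc l m n)
      (cupCocycle k G (l + m) n (cupCocycle k G l m u v) w)
      (cupCocycle k G l (m + n) u (cupCocycle k G m n v w)) fun x => ?_
    change u.1 _ * v.1 _ * w.1 _ = u.1 _ * (v.1 _ * w.1 _)
    rw [mul_assoc]
    have hw : rightMap G (l + m) n (fun b => x (Fin.cast (add_assoc l m n) b))
        = rightMap G m n (rightMap G l (m + n) x) := by
      change (fun b => x (Fin.cast (add_assoc l m n) (Fin.natAdd (l + m) b)))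
        = fun b => x (Fin.natAdd l (Fin.natAdd m b))
      funext b; congr 1; ext; simp [add_assoc]
    rw [hw]
    rfl
  natCast n := unit k G n
  natCast_zero := by rw [Nat.cast_zero, map_zero]
  natCast_succ n := by
    rw [Nat.cast_succ, map_add]; rfl

/-- The graded `k`-algebra structure on `H^•(G, k)`, so that `⨁ n, H k G n` is a `k`-algebra. -/
instance gAlgebra : DirectSum.GAlgebra k (H k G) where
  toFun := unit k G
  map_one := rfl
  map_mul r s := (gradedMonoid_eq (k := k) (G := G) (zero_add 0)
    (cupCocycle k G 0 0 ⟨LocallyConstant.const _ r, const_mem_cocycles r⟩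
      ⟨LocallyConstant.const _ s, const_mem_cocycles s⟩)
    ⟨LocallyConstant.const _ (r * s), const_mem_cocycles (r * s)⟩ fun _ => rfl).symm
  commutes r := by
    rintro ⟨n, a⟩
    obtain ⟨z, rfl⟩ := mk_surjective n a
    have e : 0 + n = n + 0 := by omega
    refine gradedMonoid_eq (k := k) (G := G) e
      (cupCocycle k G 0 n ⟨LocallyConstant.const _ r, const_mem_cocycles r⟩ z)
      (cupCocycle k G n 0 z ⟨LocallyConstant.const _ r, const_mem_cocycles r⟩) fun x => ?_
    change r * z.1 (fun b => x (Fin.cast e (Fin.natAdd 0 b))) = z.1 x * r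
    rw [mul_comm]
    congr 2; funext b; congr 1; ext; simp
  smul_def r := by
    rintro ⟨n, a⟩
    obtain ⟨z, rfl⟩ := mk_surjective n a
    refine (gradedMonoid_eq (k := k) (G := G) (zero_add n)
      (cupCocycle k G 0 n ⟨LocallyConstant.const _ r, const_mem_cocycles r⟩ z)
      (r • z) fun x => ?_).symm
    change r * z.1 (fun b => x (Fin.cast (zero_add n) (Fin.natAdd 0 b))) = r * z.1 x
    congr 2; funext b; congr 1; ext; simp

end Complex

end TrivCoh

/-! ### Quadratic algebras -/

namespace QuadAlg

variable (k : Type*) [CommRing k] (V : Type*) [AddCommGroup V] [Module k V]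

/-- The linear map `V ⊗ V → T(V)`, `v ⊗ w ↦ v w`, onto the degree two part of `T(V)`. -/
def degreeTwo : V ⊗[k] V →ₗ[k] TensorAlgebra k V :=
  LinearMap.mul' k (TensorAlgebra k V) ∘ₗ
    TensorProduct.map (TensorAlgebra.ι k) (TensorAlgebra.ι k)

variable {V}

/-- The relations `ω = 0` in `T(V)`, for `ω ∈ Ω ⊆ V ⊗ V`. -/
inductive Rel (Ω : Set (V ⊗[k] V)) : TensorAlgebra k V → TensorAlgebra k V → Prop
  | of {ω : V ⊗[k] V} (hω : ω ∈ Ω) : Rel Ω (degreeTwo k V ω) 0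

/-- The algebra `Q(V, Ω) = T(V) / (Ω)`, where `(Ω)` is the two-sided ideal generated by `Ω`. -/
abbrev Q (Ω : Set (V ⊗[k] V)) : Type _ := RingQuot (Rel k Ω)

/-- The degree `n` part of `Q(V, Ω)`: the image of `V^{⊗ n}`. -/
def Q.part (Ω : Set (V ⊗[k] V)) (n : ℕ) : Submodule k (Q k Ω) :=
  Submodule.map (RingQuot.mkAlgHom k (Rel k Ω)).toLinearMap
    (LinearMap.range (TensorAlgebra.ι k : V →ₗ[k] TensorAlgebra k V) ^ n)

end QuadAlg

/-- A graded `k`-algebra `A = ⨁ Aₙ` is quadratic if it is isomorphic, as a graded algebra, to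
`Q(A₁, Ω)` for some `Ω ⊆ A₁ ⊗ A₁`. -/
def IsQuadraticAlgebra (k : Type*) [CommRing k] (A : ℕ → Type*) [∀ n, AddCommGroup (A n)]
    [∀ n, Module k (A n)] [DirectSum.GSemiring A] [DirectSum.GAlgebra k A] : Prop :=
  ∃ (Ω : Set (A 1 ⊗[k] A 1)) (e : (⨁ n, A n) ≃ₐ[k] QuadAlg.Q k Ω),
    ∀ n, Submodule.map e.toLinearMap (LinearMap.range (DirectSum.lof k ℕ A n))
      = QuadAlg.Q.part k Ω n

/-! ### Groups -/

/-- A topological group is `H^•`-quadratic (at `p`) if its `𝔽_p`-cohomology algebra, with the cup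
product, is a quadratic algebra. -/
def IsHQuadratic (p : ℕ) (G : Type*) [Group G] [TopologicalSpace G] [IsTopologicalGroup G] :
    Prop :=
  IsQuadraticAlgebra (ZMod p) (TrivCoh.H (ZMod p) G)

/-- Pro-`p` groups: profinite groups all of whose quotients by open normal subgroups are
`p`-groups. -/
structure IsProP (p : ℕ) (G : Type*) [Group G] [TopologicalSpace G] [IsTopologicalGroup G] :
    Prop where
  compact : CompactSpace G
  t2 : T2Space G
  totallyDisconnected : TotallyDisconnectedSpace G
  isPGroup : ∀ U : Subgroup G, IsOpen (U : Set G) → ∀ [U.Normal], IsPGroup p (G ⧸ U)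

/-- `G` is topologically finitely generated. -/
def IsTopFinGen (G : Type*) [Group G] [TopologicalSpace G] [IsTopologicalGroup G] : Prop :=
  ∃ S : Set G, S.Finite ∧ (Subgroup.closure S).topologicalClosure = ⊤

/-- `G` is a `p`-elementary abelian group (possibly trivial). -/
def IsElementaryAbelian (p : ℕ) (G : Type*) [Group G] : Prop :=
  (∀ a b : G, a * b = b * a) ∧ ∀ a : G, a ^ p = 1

end

/-! The negative results use only one consequence of quadraticity: the algebra is generated in
degree one (`IsQuadraticAlgebra.range_lof_one_pow`).

Odd `p`. Degree one classes anticommute (`cup_one_one_add_swap`), so their squares vanish because 2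
is invertible, and the subalgebra they generate is a quotient of the exterior algebra on the
finite-dimensional space `H¹`. Quadraticity therefore forces `Hⁿ(G, 𝔽_p) = 0` for all large `n`.
This is incompatible with torsion. An element of prime order generates a cyclic group `C` that
embeds into a finite quotient `Q` of `G`; as `Q` is a `p`-group, `C` has order `p`. Splitting off
invariant functionals carries the vanishing from `𝔽_p` to every finite representation of `Q` over
`𝔽_p` (`exists_eq_twistedD`). Applied to the functions on `Q/C`, an explicit form of Shapiro's lemma
gives `Hⁿ(C, 𝔽_p) = 0` for large `n` (`exists_eq_funD_of_injective`). But powers of the carry class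
survive in every even degree, as their values on the cycles `∑ [a₁ | g | ⋯ | aₘ | g]` show
(`exists_cocycle_of_isCyclic`).

Elementary abelian 2-groups. The cohomology should be a polynomial ring on `H¹`. Split `G = ker χ ×
⟨σ⟩` for a nontrivial character `χ`. The homogeneous cochains invariant under `ker χ` are the `α + χ
β`, they compute the cohomology of `ker χ`, and their differential is a mapping cone for `χ ∪ ·`.
Since `ker χ` is a retract, a homotopy equivariant under it yields exact sequences `0 → Hⁿ(G) →
Hⁿ⁺¹(G) → Hⁿ⁺¹(ker χ) → 0` with first map `χ ∪ ·`. They give both the Pascal recursion for the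
number of monomials and generation by characters (`cohomology_elementaryAbelian`). An algebra
generated by commuting degree one elements and having polynomial growth is quadratic, the relations
being the commutators (`isQuadraticAlgebra_of_comm`).

Abelian 2-groups that are not elementary. For a cyclic factor of order `n` divisible by 4, the cycle
`∑ₐ [gᵃ | g]` kills products of characters, because `n(n-1)/2` is even, yet it takes the value 1 on
the carry cocycle; so `H²` is not generated in degree one. The statement on all subgroups follows by
looking at cyclic ones. -/

set_option linter.unusedSectionVars false

/-! ### Algebras generated in degree one -/

section GeneratedInDegreeOne

variable {k : Type*} {A : ℕ → Type*}

/-- A quadratic algebra is generated in degree one. -/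
lemma IsQuadraticAlgebra.range_lof_one_pow [CommRing k] [∀ n, AddCommGroup (A n)]
    [∀ n, Module k (A n)] [DirectSum.GSemiring A] [DirectSum.GAlgebra k A]
    (h : IsQuadraticAlgebra k A) (n : ℕ) :
    LinearMap.range (DirectSum.lof k ℕ A 1) ^ n = LinearMap.range (DirectSum.lof k ℕ A n) := by
  obtain ⟨Ω, e, he⟩ := h
  apply Submodule.map_injective_of_injective (f := e.toLinearMap) e.injective
  rw [he n, show e.toLinearMap = e.toAlgHom.toLinearMap from rfl, Submodule.map_pow,
    show e.toAlgHom.toLinearMap = e.toLinearMap from rfl, he 1]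
  simp only [QuadAlg.Q.part, pow_one, Submodule.map_pow]

/-- If the elements of `V` square to zero in `B`, then so do products of more than `dim V` of
them. -/
lemma range_pow_eq_bot_of_sq_eq_zero [Field k] {V B : Type*} [AddCommGroup V] [Module k V]
    [Module.Finite k V] [Semiring B] [Algebra k B] (f : V →ₗ[k] B) (hf : ∀ v, f v * f v = 0) {n : ℕ}
    (hn : Module.finrank k V < n) : LinearMap.range f ^ n = ⊥ := by
  -- The exterior algebra is universal for maps with vanishing squares, so it suffices to see that
  -- its own powers vanish beyond the dimension.
  have hE : LinearMap.range (ExteriorAlgebra.ι k : V →ₗ[k] ExteriorAlgebra k V) ^ n = ⊥ := by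
    rw [← ExteriorAlgebra.exteriorPower, ← ExteriorAlgebra.ιMulti_span_fixedDegree,
      Submodule.span_eq_bot]
    rintro _ ⟨v, rfl⟩
    refine AlternatingMap.map_linearDependent _ _ fun hv => ?_
    have := hv.fintype_card_le_finrank
    simp at this
    omega
  have hr : LinearMap.range f = Submodule.map (ExteriorAlgebra.lift k ⟨f, hf⟩).toLinearMap
      (LinearMap.range (ExteriorAlgebra.ι k : V →ₗ[k] ExteriorAlgebra k V)) := by
    rw [← LinearMap.range_comp]
    congr 1
    ext v
    simp
  rw [hr, ← Submodule.map_pow, hE, Submodule.map_bot]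

/-- The number of monomials of degree `n` in `d` variables. -/
def monomialCount : ℕ → ℕ → ℕ
  | 0, 0 => 1
  | 0, _ + 1 => 0
  | _ + 1, 0 => 1
  -- Monomials divisible by the first variable, then those free of it. The cohomology of elementary
  -- abelian groups obeys the same recursion, see `TrivCoh.finrank_H_succ`.
  | d + 1, n + 1 => monomialCount (d + 1) n + monomialCount d (n + 1)

@[simp] lemma monomialCount_zero_right (d : ℕ) : monomialCount d 0 = 1 := by
  cases d <;> simp [monomialCount]

lemma monomialCount_one (d : ℕ) : monomialCount d 1 = d := by
  induction d with
  | zero => simp [monomialCount]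
  | succ d ih => simp [monomialCount, ih, add_comm]

/-- A product of factors from `L` and `U` either has a factor from `L`, which `h` allows to be moved
to the front, or lies in a power of `U`. This is the recursion of `monomialCount` at the level of
subspaces. -/
lemma sup_pow_succ_le [Field k] {B : Type*} [Ring B] [Algebra k B] (L U : Submodule k B)
    (h : U * L ≤ L * U) (n : ℕ) : (L ⊔ U) ^ (n + 1) ≤ L * (L ⊔ U) ^ n ⊔ U ^ (n + 1) := by
  induction n with
  | zero => simp
  | succ n ih =>
    rw [pow_succ' (L ⊔ U) (n + 1), Submodule.sup_mul]
    refine sup_le le_sup_left ?_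
    calc U * (L ⊔ U) ^ (n + 1) ≤ U * (L * (L ⊔ U) ^ n ⊔ U ^ (n + 1)) := by gcongr
      _ = U * L * (L ⊔ U) ^ n ⊔ U ^ (n + 2) := by
        rw [Submodule.mul_sup, mul_assoc, ← pow_succ']
      _ ≤ L * U * (L ⊔ U) ^ n ⊔ U ^ (n + 2) := by gcongr
      _ ≤ L * (L ⊔ U) ^ (n + 1) ⊔ U ^ (n + 2) := by
        rw [mul_assoc, pow_succ' (L ⊔ U) n]
        gcongr
        exact le_sup_right

/-- The products of `n` elements of the span of `d` commuting elements span a space of dimension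
at most the number of monomials. -/
lemma finrank_span_pow_le [Field k] {B : Type*} [Ring B] [Algebra k B] (d n : ℕ) (v : Fin d → B)
    (hv : ∀ i j, v i * v j = v j * v i) :
    Module.finrank k ↥(Submodule.span k (Set.range v) ^ n) ≤ monomialCount d n := by
  have hfd : ∀ (d n : ℕ) (v : Fin d → B),
      Module.Finite k ↥(Submodule.span k (Set.range v) ^ n) := fun d n v =>
    Module.Finite.iff_fg.2 ((Submodule.fg_span (Set.finite_range v)).pow n)
  have h0 : Module.finrank k ↥(1 : Submodule k B) ≤ 1 := by
    rw [Submodule.one_eq_span]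
    exact (finrank_span_le_card _).trans (by simp)
  induction d generalizing n with
  | zero =>
    cases n with
    | zero => rw [pow_zero]; simpa [monomialCount] using h0
    | succ n => simp [monomialCount, Submodule.span_empty, pow_succ]
  | succ d ihd =>
    induction n with
    | zero => rw [pow_zero]; simpa using h0
    | succ n ihn =>
      set L := Submodule.span k {v 0} with hL
      set U := Submodule.span k (Set.range fun i : Fin d => v i.succ) with hU
      have hLU : Submodule.span k (Set.range v) = L ⊔ U := by
        rw [hL, hU, ← Submodule.span_union, Set.singleton_union,
          ← Fin.range_cons (v 0) fun i => v i.succ]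
        congr 2
        exact (Fin.cons_self_tail v).symm
      have hcomm : U * L ≤ L * U := by
        rw [hL, hU, Submodule.span_mul_span, Submodule.span_mul_span]
        apply Submodule.span_mono
        rintro _ ⟨_, ⟨i, rfl⟩, _, rfl, rfl⟩
        exact ⟨_, rfl, _, ⟨i, rfl⟩, hv _ _⟩
      have hmap : L * (L ⊔ U) ^ n = Submodule.map (LinearMap.mulLeft k (v 0)) ((L ⊔ U) ^ n) := by
        rw [hL]
        exact (Submodule.span_singleton_mul (x := v 0)).trans rfl
      have f1 := hfd (d + 1) n v
      have f2 := hfd d (n + 1) (fun i => v i.succ)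
      rw [hLU] at f1 ihn ⊢
      rw [← hU] at f2
      have f3 : Module.Finite k ↥(L * (L ⊔ U) ^ n) := by rw [hmap]; infer_instance
      calc _ ≤ Module.finrank k ↥(L * (L ⊔ U) ^ n ⊔ U ^ (n + 1)) :=
            Submodule.finrank_mono (sup_pow_succ_le L U hcomm n)
        _ ≤ Module.finrank k ↥(L * (L ⊔ U) ^ n) + Module.finrank k ↥(U ^ (n + 1)) :=
            Submodule.finrank_add_le_finrank_add_finrank _ _
        _ ≤ monomialCount (d + 1) n + monomialCount d (n + 1) := by
            refine add_le_add ?_ (ihd (n + 1) _ fun i j => hv _ _)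
            rw [hmap]
            exact (Submodule.finrank_map_le _ _).trans ihn
        _ = monomialCount (d + 1) (n + 1) := by simp [monomialCount]

lemma injective_of_surjective_of_finrank_le [Field k] {V W : Type*} [AddCommGroup V] [Module k V]
    [AddCommGroup W] [Module k W] [Module.Finite k V] (g : V →ₗ[k] W)
    (hg : Function.Surjective g) (h : Module.finrank k V ≤ Module.finrank k W) :
    Function.Injective g := by
  have h1 := LinearMap.finrank_range_add_finrank_ker g
  rw [LinearMap.range_eq_top.2 hg, finrank_top] at h1
  rw [← LinearMap.ker_eq_bot, ← Submodule.finrank_eq_zero (R := k)]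
  omega

/-- A graded algebra that is generated by a `d`-dimensional degree one part whose elements
commute, and that is as large as the polynomial algebra in `d` variables, is quadratic. -/
lemma isQuadraticAlgebra_of_comm [Field k] [∀ n, AddCommGroup (A n)]
    [∀ n, Module k (A n)] [DirectSum.GSemiring A] [DirectSum.GAlgebra k A] (d : ℕ)
    [∀ n, Module.Finite k (A n)]
    (hcomm : ∀ a b : A 1, DirectSum.lof k ℕ A 1 a * DirectSum.lof k ℕ A 1 b =
      DirectSum.lof k ℕ A 1 b * DirectSum.lof k ℕ A 1 a)
    (hgen : ∀ n, LinearMap.range (DirectSum.lof k ℕ A 1) ^ n =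
      LinearMap.range (DirectSum.lof k ℕ A n))
    (hd : ∀ n, Module.finrank k (A n) = monomialCount d n) : IsQuadraticAlgebra k A := by
  classical
  -- The relations are the commutators, so `Q` is the symmetric algebra on `A 1`. It maps onto `A`,
  -- and its graded parts are no larger than those of `A`; hence the map is bijective.
  let Ω : Set (A 1 ⊗[k] A 1) := Set.range fun ab : A 1 × A 1 => ab.1 ⊗ₜ ab.2 - ab.2 ⊗ₜ ab.1
  let Φ : QuadAlg.Q k Ω →ₐ[k] (⨁ n, A n) := RingQuot.liftAlgHom k
    ⟨TensorAlgebra.lift k (DirectSum.lof k ℕ A 1), by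
      rintro _ _ ⟨⟨⟨a, b⟩, rfl⟩⟩
      simp [QuadAlg.degreeTwo, hcomm a b]⟩
  let π := RingQuot.mkAlgHom k (QuadAlg.Rel k Ω)
  have hΦπ : ∀ t, Φ (π t) = TensorAlgebra.lift k (DirectSum.lof k ℕ A 1) t := fun t =>
    RingQuot.liftAlgHom_mkAlgHom_apply k _ _ t
  have hπ : ∀ a b : A 1, π (TensorAlgebra.ι k a) * π (TensorAlgebra.ι k b) =
      π (TensorAlgebra.ι k b) * π (TensorAlgebra.ι k a) := by
    intro a b
    have := RingQuot.mkAlgHom_rel k (QuadAlg.Rel.of (k := k) (Ω := Ω) ⟨(a, b), rfl⟩)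
    rw [map_zero] at this
    simpa [QuadAlg.degreeTwo, sub_eq_zero] using this
  have hmap : ∀ n, Submodule.map Φ.toLinearMap (QuadAlg.Q.part k Ω n) =
      LinearMap.range (DirectSum.lof k ℕ A n) := by
    intro n
    rw [← hgen n, QuadAlg.Q.part, Submodule.map_pow, Submodule.map_pow, ← LinearMap.range_comp,
      ← LinearMap.range_comp]
    congr 2
    ext a : 1
    exact (hΦπ _).trans (TensorAlgebra.lift_ι_apply _ _)
  have hpart : ∀ n, Module.Finite k ↥(QuadAlg.Q.part k Ω n) ∧
      Module.finrank k ↥(QuadAlg.Q.part k Ω n) ≤ monomialCount d n := by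
    intro n
    let b := Module.finBasisOfFinrankEq k (A 1) ((hd 1).trans (monomialCount_one d))
    have hb : QuadAlg.Q.part k Ω n =
        Submodule.span k (Set.range fun i => π (TensorAlgebra.ι k (b i))) ^ n := by
      rw [QuadAlg.Q.part, Submodule.map_pow, ← LinearMap.range_comp, LinearMap.range_eq_map,
        ← b.span_eq, Submodule.map_span, ← Set.range_comp]
      rfl
    rw [hb]
    exact ⟨Module.Finite.iff_fg.2 ((Submodule.fg_span (Set.finite_range _)).pow n),
      finrank_span_pow_le d n _ fun i j => hπ _ _⟩
  have hinjPart : ∀ n, ∀ q ∈ QuadAlg.Q.part k Ω n, Φ q = 0 → q = 0 := by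
    intro n q hq h0
    have := (hpart n).1
    let g := DirectSum.component k ℕ A n ∘ₗ Φ.toLinearMap.domRestrict (QuadAlg.Q.part k Ω n)
    have hg : Function.Surjective g := by
      rw [← LinearMap.range_eq_top, LinearMap.range_comp, LinearMap.range_domRestrict, hmap n,
        ← LinearMap.range_comp, LinearMap.range_eq_top]
      exact fun a => ⟨a, DirectSum.component.lof_self k n a⟩
    have hg' := injective_of_surjective_of_finrank_le (V := ↥(QuadAlg.Q.part k Ω n)) (W := A n) g hg
      ((hpart n).2.trans (hd n).ge)
    have h3 : g ⟨q, hq⟩ = g 0 := by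
      change DirectSum.component k ℕ A n (Φ q) = _
      rw [h0, map_zero, map_zero]
    exact congrArg Subtype.val (hg' h3)
  have hinj : Function.Injective Φ := by
    rw [injective_iff_map_eq_zero]
    intro q hq
    obtain ⟨t, rfl⟩ := RingQuot.mkAlgHom_surjective k _ q
    change Φ (π t) = 0 at hq
    change π t = 0
    let 𝒜 : ℕ → Submodule k (TensorAlgebra k (A 1)) :=
      (LinearMap.range (TensorAlgebra.ι k : A 1 →ₗ[k] TensorAlgebra k (A 1)) ^ ·)
    have hmem : ∀ n, π (DirectSum.decompose 𝒜 t n) ∈ QuadAlg.Q.part k Ω n := fun n =>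
      Submodule.mem_map_of_mem (DirectSum.decompose 𝒜 t n).2
    have ht := DirectSum.sum_support_decompose 𝒜 t
    -- `Φ ∘ π` preserves degrees, so an element of its kernel has all its homogeneous components in
    -- the kernel.
    have hz : ∀ n, Φ (π (DirectSum.decompose 𝒜 t n)) = 0 := by
      intro n
      by_cases hn : n ∈ (DirectSum.decompose 𝒜 t).support
      swap
      · rw [DFinsupp.notMem_support_iff] at hn
        simp [hn]
      have hr : ∀ m, ∃ a, DirectSum.lof k ℕ A m a = Φ (π (DirectSum.decompose 𝒜 t m)) := by
        intro m
        have : Φ (π (DirectSum.decompose 𝒜 t m)) ∈ LinearMap.range (DirectSum.lof k ℕ A m) := by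
          rw [← hmap m]
          exact Submodule.mem_map_of_mem (hmem m)
        exact this
      choose a ha using hr
      have hs : ∑ m ∈ (DirectSum.decompose 𝒜 t).support, DirectSum.lof k ℕ A m (a m) = 0 := by
        rw [← hq]
        conv_rhs => rw [← ht]
        simp [ha]
      have hc := congrArg (DirectSum.component k ℕ A n) hs
      rw [map_sum, map_zero, Finset.sum_eq_single n] at hc
      · rw [DirectSum.component.lof_self] at hc
        rw [← ha, hc, map_zero]
      · intro m _ hmn
        rw [DirectSum.component.of, dif_neg hmn]
      · exact fun h => absurd hn h
    rw [← ht, map_sum]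
    exact Finset.sum_eq_zero fun n _ => hinjPart n _ (hmem n) (hz n)
  have hsurj : Function.Surjective Φ := by
    intro a
    induction a using DirectSum.induction_on with
    | zero => exact ⟨0, map_zero _⟩
    | of n a =>
      have : DirectSum.lof k ℕ A n a ∈ Submodule.map Φ.toLinearMap (QuadAlg.Q.part k Ω n) := by
        rw [hmap]
        exact LinearMap.mem_range_self _ _
      obtain ⟨q, -, hq⟩ := this
      exact ⟨q, hq⟩
    | add a b ha hb =>
      obtain ⟨q, rfl⟩ := ha
      obtain ⟨r, rfl⟩ := hb
      exact ⟨q + r, map_add _ _ _⟩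
  let e := AlgEquiv.ofBijective Φ ⟨hinj, hsurj⟩
  refine ⟨Ω, e.symm, fun n => ?_⟩
  rw [← hmap n, ← Submodule.map_comp]
  convert Submodule.map_id _
  ext q
  exact e.symm_apply_apply q

end GeneratedInDegreeOne

/-! ### Homogeneous cochains and contractions -/

namespace TrivCoh

section Homogeneous

variable {k G : Type*} [CommRing k] [Group G]

/-- Homogeneous `n`-cochains `F(q, q x₁, …, q x₁ ⋯ xₙ)`, written as functions of
`q; x₁, …, xₙ`. -/
abbrev HomCochain (k G : Type*) (n : ℕ) : Type _ := G → (Fin n → G) → k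

/-- The differential of homogeneous cochains. -/
def homD (n : ℕ) : HomCochain k G n →+ HomCochain k G (n + 1) where
  toFun F q x := F (q * x 0) (Fin.tail x) +
    ∑ j : Fin (n + 1), (-1 : k) ^ ((j : ℕ) + 1) * F q (Fin.contractNth j (· * ·) x)
  map_zero' := by ext; simp
  map_add' F F' := by
    ext q x
    simp only [Pi.add_apply, mul_add, Finset.sum_add_distrib]
    ring

lemma homD_apply (n : ℕ) (F : HomCochain k G n) (q : G) (x : Fin (n + 1) → G) :
    homD n F q x = F (q * x 0) (Fin.tail x) +
      ∑ j : Fin (n + 1), (-1 : k) ^ ((j : ℕ) + 1) * F q (Fin.contractNth j (· * ·) x) := rfl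

/-- Insertion of a fixed first vertex `a` into a homogeneous cochain. -/
def cone (n : ℕ) (a : G) : HomCochain k G (n + 1) →+ HomCochain k G n where
  toFun F q x := F a (Fin.cons (a⁻¹ * q) x)
  map_zero' := rfl
  map_add' _ _ := rfl

lemma cone_apply (n : ℕ) (a : G) (F : HomCochain k G (n + 1)) (q : G) (x : Fin n → G) :
    cone n a F q x = F a (Fin.cons (a⁻¹ * q) x) := rfl

lemma contractNth_cons_zero {α : Type*} (op : α → α → α) {n : ℕ} (y : α) (x : Fin (n + 1) → α) :
    Fin.contractNth 0 op (Fin.cons y x : Fin (n + 2) → α) =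
      Fin.cons (op y (x 0)) (Fin.tail x) := by
  funext i
  refine Fin.cases ?_ (fun i => ?_) i
  · rw [Fin.contractNth_apply_of_eq _ _ _ _ rfl]; rfl
  · rw [Fin.contractNth_apply_of_gt _ _ _ _ (by simp)]; rfl

lemma contractNth_cons_succ {α : Type*} (op : α → α → α) {n : ℕ} (j : Fin (n + 1)) (y : α)
    (x : Fin (n + 1) → α) :
    Fin.contractNth j.succ op (Fin.cons y x : Fin (n + 2) → α) =
      Fin.cons y (Fin.contractNth j op x) := by
  funext i
  refine Fin.cases ?_ (fun i => ?_) i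
  · rw [Fin.contractNth_apply_of_lt _ _ _ _ (by simp)]; rfl
  · simp only [Fin.cons_succ, Fin.contractNth, Fin.val_succ, add_lt_add_iff_right,
      add_left_inj, ← Fin.succ_castSucc]

lemma cone_homD_zero (a : G) (F : HomCochain k G 0) (q : G) (x : Fin 0 → G) :
    cone 0 a (homD 0 F) q x = F q x - F a x := by
  rw [cone_apply, homD_apply]
  simp [Subsingleton.elim _ x, sub_eq_add_neg]

/-- The identity `cone ∘ d + d ∘ cone = id`: without an invariance condition, the homogeneous
complex is contractible in positive degrees. The face dropping the inserted vertex gives `F`; the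
remaining faces give the differential of the cone. -/
lemma cone_homD_succ (n : ℕ) (a : G) (F : HomCochain k G (n + 1)) :
    cone (n + 1) a (homD (n + 1) F) = F - homD n (cone n a F) := by
  ext q x
  rw [cone_apply, homD_apply, Fin.sum_univ_succ, contractNth_cons_zero]
  simp only [Pi.sub_apply, homD_apply, cone_apply, contractNth_cons_succ, Fin.cons_zero,
    Fin.tail_cons, Fin.val_succ, mul_inv_cancel_left, mul_assoc, Fin.val_zero]
  simp only [pow_succ, mul_neg, mul_one, neg_mul, Finset.sum_neg_distrib, pow_zero, one_mul,
    neg_neg]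
  ring

/-- Each value of `F` occurs in the cone whose inserted vertex is the first vertex of the argument.
Identities of cochains can thus be checked after coning, which lowers the degree and permits
induction. -/
lemma eq_zero_of_cone_eq_zero {n : ℕ} {F : HomCochain k G (n + 1)} (h : ∀ a, cone n a F = 0) :
    F = 0 := by
  ext q x
  have := congrFun (congrFun (h q) (q * x 0)) (Fin.tail x)
  rwa [cone_apply, inv_mul_cancel_left, Fin.cons_self_tail] at this

lemma homD_homD (n : ℕ) (F : HomCochain k G n) : homD (n + 1) (homD n F) = 0 := by
  induction n with
  | zero =>
    refine eq_zero_of_cone_eq_zero fun q => ?_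
    rw [cone_homD_succ]
    have h : cone 0 q (homD 0 F) = F - fun _ => F q := by
      ext; exact cone_homD_zero _ _ _ _
    have hc : homD 0 (fun _ : G => F q) = 0 := by
      ext; rw [homD_apply]; simp [Subsingleton.elim _ (default : Fin 0 → G)]
    rw [h, map_sub, hc]
    simp
  | succ n ih =>
    refine eq_zero_of_cone_eq_zero fun q => ?_
    rw [cone_homD_succ, cone_homD_succ, map_sub, ih]
    simp

/-- The pullback of homogeneous cochains along an endomorphism. -/
def homPull (φ : G →* G) (n : ℕ) : HomCochain k G n →+ HomCochain k G n where
  toFun F q x := F (φ q) (φ ∘ x)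
  map_zero' := rfl
  map_add' _ _ := rfl

lemma homPull_apply (φ : G →* G) (n : ℕ) (F : HomCochain k G n) (q : G) (x : Fin n → G) :
    homPull φ n F q x = F (φ q) (φ ∘ x) := rfl

lemma comp_contractNth {H : Type*} [Group H] (φ : G →* H) {n : ℕ} (j : Fin (n + 1))
    (x : Fin (n + 1) → G) :
    φ ∘ Fin.contractNth j (· * ·) x = Fin.contractNth j (· * ·) (φ ∘ x) := by
  funext i
  simp only [Function.comp, Fin.contractNth]
  split_ifs <;> simp

lemma homPull_homD (φ : G →* G) (n : ℕ) (F : HomCochain k G n) :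
    homPull φ (n + 1) (homD n F) = homD n (homPull φ n F) := by
  ext q x
  simp only [homPull_apply, homD_apply, map_mul, comp_contractNth]
  rfl

/-- The homotopy between the identity and the pullback along `φ`. -/
def homotopy (φ : G →* G) : (n : ℕ) → HomCochain k G (n + 1) → HomCochain k G n
  | 0, F => fun q x => cone 0 (φ q) F q x - cone 0 (φ q) F (φ q) (φ ∘ x)
  -- Acyclic models: the contraction towards the moving vertex `φ q` is applied to what the homotopy
  -- in the previous degree leaves over. While the lower homotopy is formed, the vertex `φ q` is
  -- kept fixed.
  | n + 1, F => fun q x => cone (n + 1) (φ q) F q x - cone (n + 1) (φ q) F (φ q) (φ ∘ x) -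
      homD n (homotopy φ n (cone (n + 1) (φ q) F)) q x

lemma homotopy_sub (φ : G →* G) (n : ℕ) (F F' : HomCochain k G (n + 1)) :
    homotopy φ n (F - F') = homotopy φ n F - homotopy φ n F' := by
  induction n with
  | zero =>
    ext q x
    simp only [homotopy, map_sub, Pi.sub_apply]
    ring
  | succ n ih =>
    ext q x
    simp only [homotopy, map_sub, Pi.sub_apply, ih]
    ring

lemma homotopy_zero (φ : G →* G) (n : ℕ) :
    homotopy φ n (0 : HomCochain k G (n + 1)) = 0 := by
  rw [← sub_self (0 : HomCochain k G (n + 1)), homotopy_sub, sub_self]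

lemma homotopy_homD_zero (φ : G →* G) (F : HomCochain k G 0) :
    homotopy φ 0 (homD 0 F) = F - homPull φ 0 F := by
  ext q x
  simp only [homotopy]
  rw [cone_homD_zero, cone_homD_zero, Pi.sub_apply, Pi.sub_apply, homPull_apply,
    Subsingleton.elim (φ ∘ x) x]
  ring

lemma homotopy_succ_apply (φ : G →* G) (n : ℕ) (F : HomCochain k G (n + 2)) (q : G)
    (x : Fin (n + 1) → G) :
    homotopy φ (n + 1) F q x = cone (n + 1) (φ q) F q x - cone (n + 1) (φ q) F (φ q) (φ ∘ x) -
      homD n (homotopy φ n (cone (n + 1) (φ q) F)) q x := rfl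

/-- This is the homotopy formula `h d + d h = id - φ^*`. Expanding `h (d F)` by the contraction
identity, the terms containing `d (cone F)` cancel as soon as `d h d = d - φ^* d` holds one degree
lower; and that follows from the formula there by applying `d` and using `d d = 0`. -/
lemma homotopy_homD_succ (φ : G →* G) (n : ℕ) (F : HomCochain k G (n + 1)) :
    homotopy φ (n + 1) (homD (n + 1) F) =
      F - homPull φ (n + 1) F - homD n (homotopy φ n F) := by
  have of_prev : ∀ n, (∀ F : HomCochain k G n, homD n (homotopy φ n (homD n F)) =
        homD n F - homPull φ (n + 1) (homD n F)) → ∀ F : HomCochain k G (n + 1),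
      homotopy φ (n + 1) (homD (n + 1) F) =
        F - homPull φ (n + 1) F - homD n (homotopy φ n F) := by
    intro n h F
    ext q x
    rw [homotopy_succ_apply, cone_homD_succ, homotopy_sub, map_sub, h]
    simp only [Pi.sub_apply, homPull_apply]
    ring
  induction n with
  | zero =>
    refine of_prev 0 (fun F => ?_) F
    rw [homotopy_homD_zero, map_sub, homPull_homD]
  | succ n ih =>
    refine of_prev (n + 1) (fun F => ?_) F
    rw [ih F, map_sub, map_sub, homD_homD, homPull_homD, sub_zero]

/-- The action of `G` on homogeneous cochains. -/
def homTranslate (g : G) {n : ℕ} (F : HomCochain k G n) : HomCochain k G n := fun q => F (g * q)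

lemma homD_homTranslate (g : G) (n : ℕ) (F : HomCochain k G n) :
    homD n (homTranslate g F) = homTranslate g (homD n F) := by
  ext q x
  simp only [homD_apply, homTranslate, mul_assoc]

lemma cone_homTranslate (g a : G) (n : ℕ) (F : HomCochain k G (n + 1)) :
    cone n a (homTranslate g F) = homTranslate g (cone n (g * a) F) := by
  ext q x
  simp only [cone_apply, homTranslate, mul_inv_rev]
  congr 2
  group

/-- The only vertices inserted are values `φ q`, and `φ (g * q) = g * φ q` for a fixed point `g`.
For a retraction onto a subgroup, the homotopy is therefore equivariant under that subgroup. -/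
lemma homotopy_homTranslate (φ : G →* G) {g : G} (hg : φ g = g) (n : ℕ)
    (F : HomCochain k G (n + 1)) :
    homotopy φ n (homTranslate g F) = homTranslate g (homotopy φ n F) := by
  induction n with
  | zero =>
    ext q x
    simp only [homotopy, cone_homTranslate]
    simp only [homTranslate, map_mul, hg]
  | succ n ih =>
    ext q x
    simp only [homotopy, cone_homTranslate, ih, homD_homTranslate]
    simp only [homTranslate, map_mul, hg]

end Homogeneous

/-! ### The kernel of a character as a retract of index two -/

section IndexTwo

variable {k G : Type*} [CommRing k] [Group G]

/-- The differential of inhomogeneous cochains, not required to be continuous. -/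
def funD (n : ℕ) (f : (Fin n → G) → k) : (Fin (n + 1) → G) → k := fun x =>
  f (Fin.tail x) + ∑ j : Fin (n + 1), (-1 : k) ^ ((j : ℕ) + 1) * f (Fin.contractNth j (· * ·) x)

/-- The cup product with a one-cochain on the left. -/
def funCup {n : ℕ} (χ : G → k) (f : (Fin n → G) → k) : (Fin (n + 1) → G) → k := fun x =>
  χ (x 0) * f (Fin.tail x)

lemma homD_const (n : ℕ) (f : (Fin n → G) → k) : homD n (fun _ : G => f) = fun _ => funD n f := rfl

/-- In the coordinates `(α, β)` of `α + χ β` the differential is `(d α + χ ∪ β, d β)`, a mapping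
cone for the cup product with `χ`. -/
lemma homD_add_mul {n : ℕ} {χ : G → k} (hχ : ∀ a b, χ (a * b) = χ a + χ b)
    (α β : (Fin n → G) → k) (q : G) (x : Fin (n + 1) → G) :
    homD n (fun q y => α y + χ q * β y) q x =
      funD n α x + funCup χ β x + χ q * funD n β x := by
  simp only [homD_apply, funD, funCup, hχ, mul_add, Finset.sum_add_distrib, Finset.mul_sum]
  simp only [mul_left_comm _ (χ q)]
  ring

/-- A homogeneous cochain that is invariant under the kernel of a character `χ` onto `{0, 1}`
is of the form `γ + χ ε`. -/
lemma exists_add_mul_of_invariant {χ : G → k} (hχ : ∀ a b, χ (a * b) = χ a + χ b)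
    (h01 : ∀ q, χ q = 0 ∨ χ q = 1) {σ : G} (hσ : χ σ = 1) {n : ℕ} (E : HomCochain k G n)
    (hE : ∀ g, χ g = 0 → homTranslate g E = E) :
    ∃ γ ε : (Fin n → G) → k, E = fun q x => γ x + χ q * ε x := by
  have h1 : χ 1 = 0 := by simpa using hχ 1 1
  have hinv : ∀ q, χ q⁻¹ = -χ q := fun q => by
    have := hχ q q⁻¹
    rw [mul_inv_cancel, h1] at this
    exact eq_neg_of_add_eq_zero_right this.symm
  refine ⟨E 1, E σ - E 1, ?_⟩
  funext q x
  rcases h01 q with h | h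
  · have := congrFun (hE q h) 1
    simp only [homTranslate, mul_one] at this
    rw [h, this]; simp
  · have := congrFun (hE (q * σ⁻¹) (by rw [hχ, hinv, h, hσ, add_neg_cancel])) σ
    simp only [homTranslate, inv_mul_cancel_right] at this
    rw [h, this]; simp

/-- Degree zero case of the injectivity of `χ ∪ ·`: the action being trivial, the differential of a
0-cochain vanishes, so evaluating at `σ` gives `h = 0`. -/
lemma eq_zero_of_funCup_eq {χ : G → k} {σ : G} (hσ : χ σ = 1)
    (h g : (Fin 0 → G) → k) (hg : funCup χ h = funD 0 g) : h = 0 := by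
  funext x
  have := congrFun hg (fun _ => σ)
  simp only [funCup, hσ, one_mul, funD] at this
  rw [Subsingleton.elim x (Fin.tail fun _ => σ), this]
  simp [Subsingleton.elim _ (default : Fin 0 → G)]

variable {χ : G → k} (hχ : ∀ a b, χ (a * b) = χ a + χ b) (h01 : ∀ q, χ q = 0 ∨ χ q = 1) {σ : G}
  (hσ : χ σ = 1) (φ : G →* G) (hφ : ∀ q, χ (φ q) = 0) (hφχ : ∀ q, χ q = 0 → φ q = q)
include hχ h01 hσ hφχ

/-- The cochain `α + χ β` is invariant under `ker χ`, whose elements are fixed by `φ`; by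
equivariance its homotopy is invariant too and has the same shape. -/
lemma homotopy_eq_add_mul {n : ℕ} (α β : (Fin (n + 1) → G) → k) :
    ∃ γ ε : (Fin n → G) → k,
      homotopy φ n (fun q x => α x + χ q * β x) = fun q x => γ x + χ q * ε x := by
  refine exists_add_mul_of_invariant hχ h01 hσ _ fun g hg => ?_
  rw [← homotopy_homTranslate φ (hφχ g hg)]
  congr 1
  funext q x
  simp [homTranslate, hχ, hg]

/-- A cocycle of positive degree whose restriction to the kernel of `χ` vanishes is cohomologous
to a multiple of `χ`. -/
lemma exists_eq_funD_add_funCup {n : ℕ} (f : (Fin (n + 1) → G) → k) (hf : funD (n + 1) f = 0) :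
    ∃ γ ε : (Fin n → G) → k, funD n ε = 0 ∧
      ∀ x, f x = f (φ ∘ x) + funD n γ x + funCup χ ε x := by
  obtain ⟨γ, ε, h⟩ := homotopy_eq_add_mul hχ h01 hσ φ hφχ f (0 : (Fin (n + 1) → G) → k)
  have hF : (fun (q : G) x => f x + χ q * (0 : (Fin (n + 1) → G) → k) x) = fun _ => f := by
    simp
  have h1 := homotopy_homD_succ φ n (fun _ : G => f)
  rw [homD_const, hf, show (fun _ : G => (0 : (Fin (n + 2) → G) → k)) = 0 from rfl,
    homotopy_zero] at h1
  rw [hF] at h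
  rw [h] at h1
  have h2 : ∀ q x, 0 = f x - f (φ ∘ x) - (funD n γ x + funCup χ ε x + χ q * funD n ε x) := by
    intro q x
    rw [← homD_add_mul hχ]
    exact congrFun (congrFun h1 q) x
  -- Evaluation at `q = 1` and at `q = σ`, where `χ` is 0 and 1, separates the two coordinates.
  have h3 : ∀ x, funD n ε x = 0 := by
    intro x
    have e1 := h2 1 x
    have e2 := h2 σ x
    have h1 : χ 1 = 0 := by simpa using hχ 1 1
    rw [hσ] at e2
    rw [h1] at e1
    linear_combination e2 - e1
  refine ⟨γ, ε, funext h3, fun x => ?_⟩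
  have := h2 1 x
  rw [h3] at this
  linear_combination -this

include hφ

/-- The product with `χ` is injective on cohomology if `ker χ` is a retract. -/
lemma exists_eq_funD_of_funCup_eq {n : ℕ} (h g : (Fin (n + 1) → G) → k) (hh : funD (n + 1) h = 0)
    (hg : funCup χ h = funD (n + 1) g) : ∃ ε : (Fin n → G) → k, h = funD n ε := by
  obtain ⟨γ, ε, he⟩ := homotopy_eq_add_mul hχ h01 hσ φ hφχ g (-h)
  -- The equation `χ ∪ h = d g` says exactly that `g - χ h` is a cocycle of the cone. Pullback along
  -- `φ` kills its `χ`-coordinate, so comparing `χ`-coordinates in the homotopy formula exhibits `h`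
  -- as a coboundary.
  have h0 : homD (n + 1) (fun q x => g x + χ q * (-h) x) = 0 := by
    have hh' : funD (n + 1) (-h) = 0 := by
      funext x
      have := congrFun hh x
      simp only [funD, Pi.neg_apply, mul_neg, Finset.sum_neg_distrib, Pi.zero_apply] at this ⊢
      linear_combination -this
    funext q x
    rw [homD_add_mul hχ, hh', ← hg]
    simp [funCup]
  have h1 := homotopy_homD_succ φ n (fun q x => g x + χ q * (-h) x)
  rw [h0, homotopy_zero, he] at h1
  have h2 : ∀ q x, 0 = g x + χ q * (-h x) - g (φ ∘ x) -
      (funD n γ x + funCup χ ε x + χ q * funD n ε x) := by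
    intro q x
    rw [← homD_add_mul hχ]
    have := congrFun (congrFun h1 q) x
    simpa [homPull_apply, hφ] using this
  refine ⟨fun x => -ε x, funext fun x => ?_⟩
  have e1 := h2 1 x
  have e2 := h2 σ x
  have h1 : χ 1 = 0 := by simpa using hχ 1 1
  rw [hσ] at e2
  rw [h1] at e1
  have e3 : funD n (fun x => -ε x) x = -funD n ε x := by
    simp only [funD, mul_neg, Finset.sum_neg_distrib]
    ring
  rw [e3]
  linear_combination e2 - e1

end IndexTwo

/-- The positive degree cohomology of the trivial group vanishes. -/
lemma exists_eq_funD_of_subsingleton {k G : Type*} [CommRing k] [Group G] [Subsingleton G] {n : ℕ}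
    (f : (Fin (n + 1) → G) → k) (hf : funD (n + 1) f = 0) : ∃ g, f = funD n g := by
  have h := cone_homD_succ n (1 : G) (fun _ => f)
  rw [homD_const, hf, show (fun _ : G => (0 : (Fin (n + 2) → G) → k)) = 0 from rfl, map_zero] at h
  refine ⟨fun x => f (Fin.cons 1 x), ?_⟩
  have h' : cone n (1 : G) (fun _ => f) = fun _ => fun x => f (Fin.cons 1 x) := by
    funext q x
    rw [cone_apply, Subsingleton.elim ((1 : G)⁻¹ * q) 1]
  rw [h', homD_const] at h
  exact congrFun (sub_eq_zero.1 h.symm) 1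

end TrivCoh

/-! ### Cohomology of finite discrete groups -/

namespace TrivCoh

section Functoriality

variable (k : Type*) {G G' : Type*} [CommRing k] [Group G] [TopologicalSpace G]
  [IsTopologicalGroup G] [Group G'] [TopologicalSpace G'] [IsTopologicalGroup G']

/-- The pullback of cochains along a continuous homomorphism. -/
def mapCochain (φ : G' →* G) (hφ : Continuous φ) (n : ℕ) : Cochain k G n →ₗ[k] Cochain k G' n :=
  LocallyConstant.comapₗ k ⟨fun x : Fin n → G' => (φ ∘ x : Fin n → G), by fun_prop⟩

variable {k}

lemma mapCochain_apply (φ : G' →* G) (hφ : Continuous φ) (n : ℕ) (f : Cochain k G n)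
    (x : Fin n → G') : mapCochain k φ hφ n f x = f (φ ∘ x) := rfl

lemma d_mapCochain (φ : G' →* G) (hφ : Continuous φ) (n : ℕ) (f : Cochain k G n) :
    d k G' n (mapCochain k φ hφ n f) = mapCochain k φ hφ (n + 1) (d k G n f) := by
  ext x
  simp only [d_apply, mapCochain_apply, comp_contractNth]
  rfl

lemma mapCochain_mem_cocycles (φ : G' →* G) (hφ : Continuous φ) {n : ℕ} {f : Cochain k G n}
    (hf : f ∈ cocycles k G n) : mapCochain k φ hφ n f ∈ cocycles k G' n := by
  rw [cocycles, LinearMap.mem_ker] at *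
  rw [d_mapCochain, hf, map_zero]

lemma mapCochain_mem_coboundaries (φ : G' →* G) (hφ : Continuous φ) {n : ℕ} {f : Cochain k G n}
    (hf : f ∈ coboundaries k G n) : mapCochain k φ hφ n f ∈ coboundaries k G' n := by
  cases n with
  | zero =>
    obtain rfl : f = 0 := hf
    exact map_zero _
  | succ n =>
    obtain ⟨g, rfl⟩ := hf
    exact ⟨mapCochain k φ hφ n g, d_mapCochain _ _ _ _⟩

variable (k)

/-- A linear map on cohomology induced by a linear map on cochains. -/
def inducedMap {m n : ℕ} (F : Cochain k G m →ₗ[k] Cochain k G' n)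
    (hF : ∀ f ∈ cocycles k G m, F f ∈ cocycles k G' n)
    (hF' : ∀ f ∈ coboundaries k G m, F f ∈ coboundaries k G' n) : H k G m →ₗ[k] H k G' n :=
  Submodule.mapQ _ _ (F.restrict hF) fun z hz => hF' z hz

variable {k}

lemma inducedMap_mk {m n : ℕ} (F : Cochain k G m →ₗ[k] Cochain k G' n)
    (hF : ∀ f ∈ cocycles k G m, F f ∈ cocycles k G' n)
    (hF' : ∀ f ∈ coboundaries k G m, F f ∈ coboundaries k G' n) (z : cocycles k G m) :
    inducedMap k F hF hF' (mk k G m z) = mk k G' n ⟨F z, hF z z.2⟩ := rfl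

variable (k)

/-- The pullback on cohomology along a continuous homomorphism. -/
def pullback (φ : G' →* G) (hφ : Continuous φ) (n : ℕ) : H k G n →ₗ[k] H k G' n :=
  inducedMap k (mapCochain k φ hφ n) (fun _ => mapCochain_mem_cocycles φ hφ)
    (fun _ => mapCochain_mem_coboundaries φ hφ)

variable {k}

lemma pullback_mk (φ : G' →* G) (hφ : Continuous φ) (n : ℕ) (z : cocycles k G n) :
    pullback k φ hφ n (mk k G n z) =
      mk k G' n ⟨mapCochain k φ hφ n z, mapCochain_mem_cocycles φ hφ z.2⟩ := rfl

lemma coe_d (n : ℕ) (f : Cochain k G n) : ⇑(d k G n f) = funD n f := funext fun x => d_apply n f x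

lemma mem_cocycles_iff {n : ℕ} {f : Cochain k G n} : f ∈ cocycles k G n ↔ funD n f = 0 := by
  rw [cocycles, LinearMap.mem_ker, ← coe_d]
  exact ⟨fun h => by rw [h]; rfl, fun h => LocallyConstant.ext (congrFun h)⟩

end Functoriality

/-! ### Products of characters -/

section Character

variable {k G : Type*} [CommRing k] [Group G]

/-- The Leibniz rule for a character, read off from `d d = 0` on the homogeneous cochain `χ(q) f(y)`
at `q = 1`. -/
lemma funD_funCup {χ : G → k} (hχ : ∀ a b, χ (a * b) = χ a + χ b) (n : ℕ)
    (f : (Fin n → G) → k) : funD (n + 1) (funCup χ f) = -funCup χ (funD n f) := by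
  have h1 : χ 1 = 0 := by simpa using hχ 1 1
  have h := homD_homD n (fun q y => (0 : (Fin n → G) → k) y + χ q * f y)
  have h0 : funD n (0 : (Fin n → G) → k) = 0 := by
    funext x; simp [funD]
  have h2 : homD n (fun q y => (0 : (Fin n → G) → k) y + χ q * f y) =
      fun q y => funCup χ f y + χ q * funD n f y := by
    funext q x
    rw [homD_add_mul hχ, h0]
    simp
  rw [h2] at h
  funext x
  have h3 := congrFun (congrFun h 1) x
  rw [homD_add_mul hχ, h1] at h3
  simp only [Pi.zero_apply, zero_mul, add_zero] at h3
  exact eq_neg_of_add_eq_zero_left h3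

variable (k G)

/-- The span of the products of `n` characters. -/
def charProducts : (n : ℕ) → Submodule k ((Fin n → G) → k)
  | 0 => ⊤
  | n + 1 => Submodule.span k {g | ∃ χ : G → k, (∀ a b, χ (a * b) = χ a + χ b) ∧
      ∃ f ∈ charProducts n, g = funCup χ f}

variable {k G}

lemma funCup_mem_charProducts {χ : G → k} (hχ : ∀ a b, χ (a * b) = χ a + χ b) {n : ℕ}
    {f : (Fin n → G) → k} (hf : f ∈ charProducts k G n) :
    funCup χ f ∈ charProducts k G (n + 1) :=
  Submodule.subset_span ⟨χ, hχ, f, hf, rfl⟩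

lemma charProducts_comp {G' : Type*} [Group G'] (φ : G' →* G) {n : ℕ} {f : (Fin n → G) → k}
    (hf : f ∈ charProducts k G n) :
    (fun x : Fin n → G' => f (φ ∘ x)) ∈ charProducts k G' n := by
  induction n with
  | zero => trivial
  | succ n ih =>
    induction hf using Submodule.span_induction with
    | mem g hg =>
      obtain ⟨χ, hχ, f, hf, rfl⟩ := hg
      exact funCup_mem_charProducts (χ := fun a => χ (φ a))
        (fun a b => by rw [map_mul, hχ]) (ih hf)
    | zero => exact Submodule.zero_mem _
    | add f g _ _ hf hg => exact Submodule.add_mem _ hf hg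
    | smul c f _ hf => exact Submodule.smul_mem _ c hf

end Character

/-! ### Cochains of discrete groups -/

section Discrete

variable {k G : Type*} [CommRing k] [Group G] [TopologicalSpace G] [IsTopologicalGroup G]
  [DiscreteTopology G]

/-- On a finite power of a discrete group, every function is a continuous cochain. -/
def ofFun (n : ℕ) : ((Fin n → G) → k) →ₗ[k] Cochain k G n where
  toFun f := ⟨f, IsLocallyConstant.of_discrete f⟩
  map_add' _ _ := rfl
  map_smul' _ _ := rfl

@[simp] lemma coe_ofFun (n : ℕ) (f : (Fin n → G) → k) : ⇑(ofFun n f) = f := rfl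

lemma d_ofFun (n : ℕ) (f : (Fin n → G) → k) : d k G n (ofFun n f) = ofFun (n + 1) (funD n f) :=
  LocallyConstant.ext fun x => d_apply n _ x

lemma ofFun_coe (n : ℕ) (f : Cochain k G n) : ofFun n ⇑f = f := rfl

/-- The product with a character on cochains. -/
def charMul (χ : G → k) (n : ℕ) : Cochain k G n →ₗ[k] Cochain k G (n + 1) where
  toFun f := ofFun (n + 1) (funCup χ f)
  map_add' _ _ := LocallyConstant.ext fun _ => mul_add _ _ _
  map_smul' _ _ := LocallyConstant.ext fun _ => mul_left_comm _ _ _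

lemma coe_charMul (χ : G → k) (n : ℕ) (f : Cochain k G n) : ⇑(charMul χ n f) = funCup χ f := rfl

lemma charMul_mem_cocycles {χ : G → k} (hχ : ∀ a b, χ (a * b) = χ a + χ b) {n : ℕ}
    {f : Cochain k G n} (hf : f ∈ cocycles k G n) : charMul χ n f ∈ cocycles k G (n + 1) := by
  rw [mem_cocycles_iff] at *
  rw [coe_charMul, funD_funCup hχ, hf]
  funext x
  simp [funCup]

lemma charMul_mem_coboundaries {χ : G → k} (hχ : ∀ a b, χ (a * b) = χ a + χ b) {n : ℕ}
    {f : Cochain k G n} (hf : f ∈ coboundaries k G n) :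
    charMul χ n f ∈ coboundaries k G (n + 1) := by
  cases n with
  | zero =>
    obtain rfl : f = 0 := hf
    rw [map_zero]
    exact Submodule.zero_mem _
  | succ n =>
    obtain ⟨g, rfl⟩ := hf
    refine ⟨-charMul χ n g, LocallyConstant.ext fun x => ?_⟩
    rw [map_neg, coe_charMul, coe_d, ← neg_neg (funCup χ _), ← funD_funCup hχ, ← coe_charMul,
      ← coe_d]
    rfl

lemma d_zero (f : Cochain k G 0) : d k G 0 f = 0 := by
  ext x
  rw [d_apply]
  simp [Subsingleton.elim _ (default : Fin 0 → G)]

lemma finrank_H_zero {k : Type*} [Field k] : Module.finrank k (H k G 0) = 1 := by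
  refine finrank_eq_one (mk k G 0 ⟨ofFun 0 1, ?_⟩) ?_ fun w => ?_
  · exact d_zero _
  · intro h
    rw [mk_eq_zero_iff] at h
    have : (ofFun 0 1 : Cochain k G 0) = 0 := h
    have := congrArg (fun f : Cochain k G 0 => f default) this
    simp at this
  · obtain ⟨z, rfl⟩ := mk_surjective 0 w
    refine ⟨z.1 default, ?_⟩
    rw [← map_smul]
    congr 1
    ext x
    change z.1 default * 1 = z.1 x
    rw [mul_one, Subsingleton.elim x default]

instance finite_H {k : Type*} [Field k] [Finite G] (n : ℕ) : Module.Finite k (H k G n) := by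
  have h1 : Module.Finite k (Cochain k G n) :=
    Module.Finite.of_injective (LocallyConstant.coeFnₗ k) LocallyConstant.coe_injective
  exact Module.Finite.of_surjective (mk k G n) (mk_surjective n)

end Discrete

end TrivCoh

/-! ### Elementary abelian `2`-groups -/

namespace TrivCoh

section Retract

variable {k G G' : Type*} [Field k] [Group G] [TopologicalSpace G] [IsTopologicalGroup G]
  [DiscreteTopology G] [Group G'] [TopologicalSpace G'] [IsTopologicalGroup G']
  [DiscreteTopology G'] {χ : G → k} (hχ : ∀ a b, χ (a * b) = χ a + χ b)
  (h01 : ∀ q, χ q = 0 ∨ χ q = 1) {σ : G} (hσ : χ σ = 1) (i : G' →* G) (r : G →* G')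
  (hri : ∀ a, r (i a) = a) (hχi : ∀ a, χ (i a) = 0) (hir : ∀ q, χ q = 0 → i (r q) = q)
include hχ h01 hσ hir

lemma exists_eq_of_mem_cocycles {n : ℕ} {f : Cochain k G (n + 1)} (hf : f ∈ cocycles k G (n + 1)) :
    ∃ (γ : Cochain k G n) (ε : cocycles k G n),
      f = mapCochain k r continuous_of_discreteTopology (n + 1)
          (mapCochain k i continuous_of_discreteTopology (n + 1) f) +
        d k G n γ + charMul χ n ε := by
  obtain ⟨γ, ε, hε, h⟩ :=
    exists_eq_funD_add_funCup hχ h01 hσ (i.comp r) hir f (mem_cocycles_iff.1 hf)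
  refine ⟨ofFun n γ, ⟨ofFun n ε, mem_cocycles_iff.2 hε⟩, LocallyConstant.ext fun x => ?_⟩
  rw [d_ofFun]
  exact h x

/-- A cocycle is, up to a coboundary, the inflation of its restriction to `G'` plus `χ` times a
cocycle of lower degree. Both pieces are products of characters modulo coboundaries, and inflation
and multiplication by `χ` preserve such products. -/
lemma mem_charProducts_sup_coboundaries {n : ℕ}
    (h' : ∀ f ∈ cocycles k G' (n + 1),
      ∃ p ∈ charProducts k G' (n + 1), f - ofFun (n + 1) p ∈ coboundaries k G' (n + 1))
    (h : ∀ f ∈ cocycles k G n, ∃ p ∈ charProducts k G n, f - ofFun n p ∈ coboundaries k G n) :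
    ∀ f ∈ cocycles k G (n + 1),
      ∃ p ∈ charProducts k G (n + 1), f - ofFun (n + 1) p ∈ coboundaries k G (n + 1) := by
  intro f hf
  obtain ⟨γ, ε, hfe⟩ := exists_eq_of_mem_cocycles hχ h01 hσ i r hir hf
  obtain ⟨p, hp, hp'⟩ := h' _ (mapCochain_mem_cocycles i continuous_of_discreteTopology hf)
  obtain ⟨s, hs, hs'⟩ := h ε ε.2
  refine ⟨(fun x => p (r ∘ x)) + funCup χ s,
    Submodule.add_mem _ (charProducts_comp r hp) (funCup_mem_charProducts hχ hs), ?_⟩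
  have e : f - ofFun (n + 1) ((fun x => p (r ∘ x)) + funCup χ s) =
      mapCochain k r continuous_of_discreteTopology (n + 1)
        (mapCochain k i continuous_of_discreteTopology (n + 1) f - ofFun (n + 1) p) +
      d k G n γ + charMul χ n (ε - ofFun n s) := by
    rw [map_sub, map_sub, map_add]
    nth_rewrite 1 [hfe]
    have e1 : mapCochain k r continuous_of_discreteTopology (n + 1) (ofFun (n + 1) p) =
      ofFun (n + 1) (fun x => p (r ∘ x)) := rfl
    have e2 : charMul χ n (ofFun n s) = ofFun (n + 1) (funCup χ s) := rfl
    rw [e1, e2]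
    abel
  rw [e]
  exact Submodule.add_mem _ (Submodule.add_mem _ (mapCochain_mem_coboundaries _ _ hp') ⟨γ, rfl⟩)
    (charMul_mem_coboundaries hχ hs')

include hri hχi

/-- Dimension count in `0 → Hⁿ(G) → Hⁿ⁺¹(G) → Hⁿ⁺¹(G') → 0`, with maps `χ ∪ ·` and restriction along
`i`. Restriction is onto because `r` retracts `i`. -/
lemma finrank_H_succ [Finite G] [Finite G'] (n : ℕ) :
    Module.finrank k (H k G (n + 1)) =
      Module.finrank k (H k G n) + Module.finrank k (H k G' (n + 1)) := by
  have ci : Continuous i := continuous_of_discreteTopology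
  have cr : Continuous r := continuous_of_discreteTopology
  let R := pullback k i ci (n + 1)
  let M := inducedMap k (charMul χ n) (fun _ => charMul_mem_cocycles hχ)
    (fun _ => charMul_mem_coboundaries hχ)
  have hR : Function.Surjective R := by
    intro w
    obtain ⟨z, rfl⟩ := mk_surjective _ w
    refine ⟨pullback k r cr (n + 1) (mk k G' (n + 1) z), ?_⟩
    rw [pullback_mk, pullback_mk]
    congr 1
    ext x
    change z.1 (r ∘ i ∘ x) = z.1 x
    congr 1
    funext a
    exact hri _
  have hM : Function.Injective M := by
    rw [← LinearMap.ker_eq_bot, LinearMap.ker_eq_bot']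
    intro w hw
    obtain ⟨z, rfl⟩ := mk_surjective _ w
    rw [inducedMap_mk, mk_eq_zero_iff] at hw
    obtain ⟨g, hg⟩ := hw
    have hg' : funCup χ z.1 = funD n g := by
      rw [← coe_d, hg]; rfl
    rw [mk_eq_zero_iff]
    cases n with
    | zero =>
      have := eq_zero_of_funCup_eq hσ _ _ hg'
      exact LocallyConstant.ext (congrFun this)
    | succ n =>
      obtain ⟨ε, hε⟩ := exists_eq_funD_of_funCup_eq hχ h01 hσ (i.comp r) (fun q => hχi _) hir _ _
        (mem_cocycles_iff.1 z.2) hg'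
      refine ⟨ofFun n ε, LocallyConstant.ext fun x => ?_⟩
      rw [d_ofFun, coe_ofFun, ← hε]
  have hker : LinearMap.ker R = LinearMap.range M := by
    ext w
    obtain ⟨z, rfl⟩ := mk_surjective _ w
    constructor
    · intro hw
      rw [LinearMap.mem_ker, pullback_mk, mk_eq_zero_iff] at hw
      obtain ⟨γ, ε, hz⟩ := exists_eq_of_mem_cocycles hχ h01 hσ i r hir z.2
      refine ⟨mk k G n ε, ?_⟩
      rw [inducedMap_mk, ← sub_eq_zero, ← map_sub, ← neg_eq_zero, ← map_neg, mk_eq_zero_iff]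
      have e : ((-(⟨charMul χ n ε, charMul_mem_cocycles hχ ε.2⟩ - z) : cocycles k G (n + 1)) :
          Cochain k G (n + 1)) = mapCochain k r cr (n + 1) (mapCochain k i ci (n + 1) z) +
            d k G n γ := by
        change -(charMul χ n ε - z.1) = _
        nth_rewrite 1 [hz]
        abel
      rw [e]
      exact Submodule.add_mem _ (mapCochain_mem_coboundaries r cr hw) ⟨γ, rfl⟩
    · rintro ⟨w, hw⟩
      obtain ⟨ε, rfl⟩ := mk_surjective _ w
      rw [← hw, LinearMap.mem_ker, inducedMap_mk, pullback_mk, mk_eq_zero_iff]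
      convert Submodule.zero_mem _
      ext x
      change χ (i (x 0)) * _ = 0
      rw [hχi, zero_mul]
  have h := LinearMap.finrank_range_add_finrank_ker R
  rw [hker, LinearMap.finrank_range_of_inj hM, LinearMap.range_eq_top.2 hR, finrank_top] at h
  omega

end Retract

/-- The group is a vector space over `ZMod 2`, and linear functionals separate points. -/
lemma exists_character {G : Type*} [Group G] (hG : IsElementaryAbelian 2 G) {g : G} (hg : g ≠ 1) :
    ∃ χ : G →* Multiplicative (ZMod 2), χ g ≠ 1 := by
  let _ : CommGroup G := { (inferInstance : Group G) with mul_comm := hG.1 }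
  let _ : Module (ZMod 2) (Additive G) := AddCommGroup.zmodModule (n := 2) fun x => hG.2 x.toMul
  obtain ⟨f, hf⟩ : ∃ f : Module.Dual (ZMod 2) (Additive G), f (Additive.ofMul g) ≠ 0 := by
    by_contra! h
    exact hg ((Module.forall_dual_apply_eq_zero_iff (ZMod 2) (Additive.ofMul g)).1 h)
  exact ⟨AddMonoidHom.toMultiplicativeRight f.toAddMonoidHom, hf⟩

/-- The cohomology of an elementary abelian `2`-group of rank `d`: its Hilbert series, and
generation by characters. -/
theorem cohomology_elementaryAbelian (d : ℕ) (G : Type*) [Group G] [TopologicalSpace G]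
    [IsTopologicalGroup G] [DiscreteTopology G] [Finite G] (hG : IsElementaryAbelian 2 G)
    (hd : Nat.card G = 2 ^ d) (n : ℕ) :
    Module.finrank (ZMod 2) (H (ZMod 2) G n) = monomialCount d n ∧
      ∀ f ∈ cocycles (ZMod 2) G n, ∃ p ∈ charProducts (ZMod 2) G n,
        f - ofFun n p ∈ coboundaries (ZMod 2) G n := by
  induction d generalizing G n with
  | zero =>
    have : Subsingleton G := (Nat.card_eq_one_iff_unique.1 (by simpa using hd)).1
    cases n with
    | zero =>
      refine ⟨by simpa using finrank_H_zero, fun f _ => ⟨f, trivial, ?_⟩⟩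
      rw [ofFun_coe, sub_self]
      exact Submodule.zero_mem _
    | succ n =>
      have h : ∀ f ∈ cocycles (ZMod 2) G (n + 1), f ∈ coboundaries (ZMod 2) G (n + 1) := by
        intro f hf
        obtain ⟨g, hg⟩ := exists_eq_funD_of_subsingleton _ (mem_cocycles_iff.1 hf)
        refine ⟨ofFun n g, LocallyConstant.ext fun x => ?_⟩
        rw [d_ofFun, coe_ofFun, hg]
      constructor
      · rw [monomialCount, Module.finrank_eq_zero_iff_of_free, subsingleton_iff_forall_eq 0]
        intro w
        obtain ⟨z, rfl⟩ := mk_surjective _ w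
        exact (mk_eq_zero_iff _).2 (h z z.2)
      · intro f hf
        refine ⟨0, Submodule.zero_mem _, ?_⟩
        rw [map_zero, sub_zero]
        exact h f hf
  | succ d ih =>
    obtain ⟨g, hg⟩ : ∃ g : G, g ≠ 1 := by
      by_contra! h
      have : Subsingleton G := ⟨fun a b => (h a).trans (h b).symm⟩
      rw [Nat.card_of_subsingleton (1 : G)] at hd
      have := Nat.one_lt_two_pow (n := d + 1) (by omega)
      omega
    obtain ⟨ψ, hψ⟩ := exists_character hG hg
    let χ : G → ZMod 2 := fun a => (ψ a).toAdd
    have hχ : ∀ a b, χ (a * b) = χ a + χ b := fun a b => by simp [χ]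
    have h01 : ∀ q, χ q = 0 ∨ χ q = 1 := fun q => by
      generalize χ q = c
      revert c
      decide
    have hσ : χ g = 1 := (h01 g).resolve_left hψ
    have hχker : ∀ a, χ a = 0 ↔ a ∈ ψ.ker := fun a => Iff.rfl
    have hgg : g * g = 1 := by rw [← pow_two]; exact hG.2 g
    have hrmem : ∀ q, χ q ≠ 0 → χ (q * g) = 0 := fun q hq => by
      rw [hχ, (h01 q).resolve_left hq, hσ]
      rfl
    -- Projection onto `ker χ` along `⟨g⟩`; it is multiplicative because `G` is abelian and `g * g =
    -- 1`.
    let r₀ : G → G := fun q => if χ q = 0 then q else q * g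
    have hr₀ : ∀ q, χ (r₀ q) = 0 := fun q => by
      by_cases h : χ q = 0
      · simp [r₀, h]
      · simp [r₀, h, hrmem q h]
    have hr₀mul : ∀ a b, r₀ (a * b) = r₀ a * r₀ b := by
      intro a b
      have hab : a * b * g = a * g * b := by rw [mul_assoc, hG.1 b g, mul_assoc]
      rcases h01 a with ha | ha <;> rcases h01 b with hb | hb
      · simp [r₀, hχ, ha, hb]
      · simp [r₀, hχ, ha, hb, mul_assoc]
      · simp [r₀, hχ, ha, hb, hab]
      · have : (1 : ZMod 2) + 1 = 0 := rfl
        simp only [r₀, hχ, ha, hb, this, one_ne_zero, if_true, if_false]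
        rw [← mul_assoc, mul_assoc a g b, hG.1 g b, ← mul_assoc, mul_assoc, hgg, mul_one]
    let r : G →* ψ.ker := MonoidHom.mk' (fun q => ⟨r₀ q, hr₀ q⟩) fun a b =>
      Subtype.ext (hr₀mul a b)
    let i : ψ.ker →* G := ψ.ker.subtype
    have hir : ∀ q, χ q = 0 → i (r q) = q := fun q hq => by
      change r₀ q = q
      simp [r₀, hq]
    have hχi : ∀ a, χ (i a) = 0 := fun a => a.2
    have hri : ∀ a, r (i a) = a := fun a => Subtype.ext (hir _ (hχi a))
    have hK : IsElementaryAbelian 2 ψ.ker :=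
      ⟨fun a b => Subtype.ext (hG.1 _ _), fun a => Subtype.ext (hG.2 _)⟩
    have hcard : Nat.card ψ.ker = 2 ^ d := by
      have h1 := ψ.ker.card_mul_index
      have hsurj : Function.Surjective ψ := fun c => by
        rcases (show ∀ c : ZMod 2, c = 0 ∨ c = 1 by decide) c.toAdd with h | h
        · exact ⟨1, by rw [map_one]; exact h.symm⟩
        · exact ⟨g, hσ.trans h.symm⟩
      rw [Subgroup.index_ker, MonoidHom.range_eq_top.2 hsurj, Subgroup.card_top, hd,
        show Nat.card (Multiplicative (ZMod 2)) = 2 from Nat.card_zmod 2] at h1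
      rw [pow_succ] at h1
      omega
    induction n with
    | zero =>
      refine ⟨by simpa using finrank_H_zero, fun f _ => ⟨f, trivial, ?_⟩⟩
      rw [ofFun_coe, sub_self]
      exact Submodule.zero_mem _
    | succ n ihn =>
      have hn := ih ψ.ker hK hcard (n + 1)
      refine ⟨?_, mem_charProducts_sup_coboundaries hχ h01 hσ i r hir hn.2 ihn.2⟩
      rw [finrank_H_succ hχ h01 hσ i r hri hχi hir, ihn.1, hn.1, monomialCount]

/-! ### Products of degree one classes -/

lemma funD_one {k G : Type*} [CommRing k] [Group G] (f : (Fin 1 → G) → k) (x : Fin 2 → G) :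
    funD 1 f x = f (fun _ => x 1) - f (fun _ => x 0 * x 1) + f (fun _ => x 0) := by
  have e1 : (Fin.tail x : Fin 1 → G) = fun _ => x 1 := by
    funext i; rw [Subsingleton.elim i 0]; rfl
  have e2 : (Fin.contractNth 0 (· * ·) x : Fin 1 → G) = fun _ => x 0 * x 1 := by
    funext i; rw [Subsingleton.elim i 0]; rfl
  have e3 : (Fin.contractNth 1 (· * ·) x : Fin 1 → G) = fun _ => x 0 := by
    funext i; rw [Subsingleton.elim i 0]; rfl
  rw [funD, e1, Fin.sum_univ_two (f := fun j : Fin 2 => (-1 : k) ^ ((j : ℕ) + 1) *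
    f (Fin.contractNth (n := 1) j (· * ·) x)), e2, e3]
  simp
  ring

section DegreeOne

variable {k G : Type*} [CommRing k] [Group G] [TopologicalSpace G] [IsTopologicalGroup G]

/-- One-cochains as functions on `G`. -/
def evalOne : Cochain k G 1 →ₗ[k] (G → k) where
  toFun f g := f fun _ => g
  map_add' _ _ := rfl
  map_smul' _ _ := rfl

lemma evalOne_apply (f : Cochain k G 1) (g : G) : evalOne f g = f fun _ => g := rfl

lemma evalOne_mul {f : Cochain k G 1} (hf : f ∈ cocycles k G 1) (a b : G) :
    evalOne f (a * b) = evalOne f a + evalOne f b := by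
  rw [mem_cocycles_iff] at hf
  have h := congrFun hf ![a, b]
  rw [funD_one] at h
  simp only [Matrix.cons_val_zero, Matrix.cons_val_one, Pi.zero_apply] at h
  rw [evalOne_apply, evalOne_apply, evalOne_apply]
  linear_combination -h

lemma cupCochain_one_one_apply (f h : Cochain k G 1) (x : Fin 2 → G) :
    cupCochain k G 1 1 f h x = evalOne f (x 0) * evalOne h (x 1) := by
  rw [cupCochain_apply, evalOne_apply, evalOne_apply]
  congr 2 <;> funext i <;> rw [Subsingleton.elim i 0] <;> rfl

/-- The cup product of degree one classes is anticommutative. -/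
lemma cup_one_one_add_swap (a b : H k G 1) : cup k G 1 1 a b + cup k G 1 1 b a = 0 := by
  obtain ⟨f, rfl⟩ := mk_surjective _ a
  obtain ⟨h, rfl⟩ := mk_surjective _ b
  rw [cup_mk, cup_mk, ← map_add, mk_eq_zero_iff]
  -- For characters, `d (f h) (x, y) = -(f x * h y + f y * h x)`, with `f h` the pointwise product.
  refine ⟨-(f.1 * h.1), LocallyConstant.ext fun x => ?_⟩
  change d k G 1 (-(f.1 * h.1)) x = cupCochain k G 1 1 f h x + cupCochain k G 1 1 h f x
  rw [cupCochain_one_one_apply, cupCochain_one_one_apply, coe_d, funD_one]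
  change -(evalOne f.1 (x 1) * evalOne h.1 (x 1)) - -(evalOne f.1 (x 0 * x 1) *
    evalOne h.1 (x 0 * x 1)) + -(evalOne f.1 (x 0) * evalOne h.1 (x 0)) = _
  rw [evalOne_mul f.2, evalOne_mul h.2]
  ring

lemma lof_mul_lof {m n : ℕ} (a : H k G m) (b : H k G n) :
    DirectSum.lof k ℕ (H k G) m a * DirectSum.lof k ℕ (H k G) n b =
      DirectSum.lof k ℕ (H k G) (m + n) (cup k G m n a b) :=
  DirectSum.of_mul_of a b

lemma lof_one_mul_swap (a b : H k G 1) :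
    DirectSum.lof k ℕ (H k G) 1 a * DirectSum.lof k ℕ (H k G) 1 b +
      DirectSum.lof k ℕ (H k G) 1 b * DirectSum.lof k ℕ (H k G) 1 a = 0 := by
  rw [lof_mul_lof, lof_mul_lof, ← map_add, cup_one_one_add_swap, map_zero]

lemma range_lof_one_pow_le (n : ℕ) : LinearMap.range (DirectSum.lof k ℕ (H k G) 1) ^ n ≤
    LinearMap.range (DirectSum.lof k ℕ (H k G) n) := by
  induction n with
  | zero =>
    rw [pow_zero, Submodule.one_le]
    exact ⟨unit k G 1, rfl⟩
  | succ n ih =>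
    rw [pow_succ, Submodule.mul_le]
    rintro a ha _ ⟨b, rfl⟩
    obtain ⟨a, rfl⟩ := ih ha
    exact ⟨_, (lof_mul_lof a b).symm⟩

/-- A product of characters is a cocycle, and its class is a product of degree one classes. -/
lemma lof_mk_mem_range_pow [DiscreteTopology G] {n : ℕ} {p : (Fin n → G) → k}
    (hp : p ∈ charProducts k G n) : ∃ h : ofFun n p ∈ cocycles k G n,
      DirectSum.lof k ℕ (H k G) n (mk k G n ⟨ofFun n p, h⟩) ∈
        LinearMap.range (DirectSum.lof k ℕ (H k G) 1) ^ n := by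
  induction n with
  | zero =>
    refine ⟨d_zero _, ?_⟩
    rw [pow_zero, Submodule.mem_one]
    refine ⟨p default, congrArg (fun z => DirectSum.lof k ℕ (H k G) 0 (mk k G 0 z))
      (?_ : (⟨LocallyConstant.const _ (p default), const_mem_cocycles _⟩ : cocycles k G 0) = _)⟩
    exact Subtype.ext (LocallyConstant.ext fun x => congrArg p (Subsingleton.elim _ _))
  | succ n ih =>
    induction hp using Submodule.span_induction with
    | mem g hg =>
      obtain ⟨χ, hχ, f, hf, rfl⟩ := hg
      obtain ⟨h, hh⟩ := ih hf
      have hχ' : ofFun 1 (fun x => χ (x 0)) ∈ cocycles k G 1 := by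
        rw [mem_cocycles_iff]
        funext x
        rw [coe_ofFun, funD_one, hχ]
        simp
      refine ⟨charMul_mem_cocycles hχ h, ?_⟩
      have e : DirectSum.lof k ℕ (H k G) (n + 1)
          (mk k G (n + 1) ⟨charMul χ n (ofFun n f), charMul_mem_cocycles hχ h⟩) =
          DirectSum.lof k ℕ (H k G) 1 (mk k G 1 ⟨_, hχ'⟩) *
            DirectSum.lof k ℕ (H k G) n (mk k G n ⟨_, h⟩) := by
        rw [lof_mul_lof, cup_mk]
        refine (DirectSum.of_eq_of_gradedMonoid_eq (gradedMonoid_eq (add_comm 1 n) _ _ ?_)).symm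
        intro x
        change χ _ * f _ = χ _ * f _
        congr 1
        refine congrArg f (funext fun a => congrArg x (Fin.ext ?_))
        simp
      change DirectSum.lof k ℕ (H k G) (n + 1)
          (mk k G (n + 1) ⟨charMul χ n (ofFun n f), charMul_mem_cocycles hχ h⟩) ∈ _
      rw [e, pow_succ']
      exact Submodule.mul_mem_mul (LinearMap.mem_range_self _ _) hh
    | zero =>
      refine ⟨Submodule.zero_mem _, ?_⟩
      convert Submodule.zero_mem _
      exact (congrArg _ (map_zero (mk k G (n + 1)))).trans (map_zero _)
    | add f g _ _ hf hg =>
      obtain ⟨h1, h2⟩ := hf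
      obtain ⟨h3, h4⟩ := hg
      refine ⟨Submodule.add_mem _ h1 h3, ?_⟩
      convert Submodule.add_mem _ h2 h4
      rw [← map_add, ← map_add]
      rfl
    | smul c f _ hf =>
      obtain ⟨h1, h2⟩ := hf
      refine ⟨Submodule.smul_mem _ c h1, ?_⟩
      convert Submodule.smul_mem _ c h2
      rw [← map_smul, ← map_smul]
      rfl

end DegreeOne

end TrivCoh

/-- Finite elementary abelian `2`-groups are `H^•`-quadratic. -/
theorem isHQuadratic_of_isElementaryAbelian (G : Type*) [Group G] [TopologicalSpace G]
    [IsTopologicalGroup G] [DiscreteTopology G] [Finite G] (hG : IsElementaryAbelian 2 G) :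
    IsHQuadratic 2 G := by
  open TrivCoh in
  obtain ⟨d, hd⟩ : ∃ d, Nat.card G = 2 ^ d :=
    IsPGroup.iff_card.1 fun g => ⟨1, by rw [pow_one]; exact hG.2 g⟩
  have key := cohomology_elementaryAbelian d G hG hd
  refine isQuadraticAlgebra_of_comm d (fun a b => ?_) (fun n => ?_) fun n => (key n).1
  · have h1 := lof_one_mul_swap a b
    have h2 : ∀ x : ⨁ n, H (ZMod 2) G n, x + x = 0 := fun x => by
      rw [← two_smul (ZMod 2) x, show (2 : ZMod 2) = 0 from rfl, zero_smul]
    calc _ = _ + (_ + _) := by rw [h2 (DirectSum.lof (ZMod 2) ℕ (H (ZMod 2) G) 1 b *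
              DirectSum.lof (ZMod 2) ℕ (H (ZMod 2) G) 1 a), add_zero]
      _ = _ := by rw [← add_assoc, h1, zero_add]
  · refine le_antisymm (range_lof_one_pow_le n) ?_
    rintro _ ⟨w, rfl⟩
    obtain ⟨z, rfl⟩ := mk_surjective n w
    obtain ⟨p, hp, hzp⟩ := (key n).2 z z.2
    obtain ⟨h1, h2⟩ := lof_mk_mem_range_pow hp
    have : mk (ZMod 2) G n z = mk (ZMod 2) G n ⟨ofFun n p, h1⟩ := by
      rw [← sub_eq_zero, ← map_sub, mk_eq_zero_iff]
      exact hzp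
    rw [this]
    exact h2

/-! ### Abelian `2`-groups with quadratic cohomology -/

/-- The carry of the addition of two residues modulo `n`. -/
def carry (n : ℕ) (a b : ZMod n) : ℕ := (a.val + b.val) / n

lemma val_add_add_carry {n : ℕ} [NeZero n] (a b : ZMod n) :
    (a + b).val + n * carry n a b = a.val + b.val := by
  rw [ZMod.val_add, carry, Nat.mod_add_div]

/-- `n` times the carry is the coboundary of `ZMod.val`, so the cocycle identity holds after
multiplication by `n`, which can be cancelled in `ℕ`. -/
lemma carry_cocycle {n : ℕ} [NeZero n] (a b c : ZMod n) :
    carry n b c + carry n a (b + c) = carry n (a + b) c + carry n a b := by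
  have h1 := val_add_add_carry b c
  have h2 := val_add_add_carry a (b + c)
  have h3 := val_add_add_carry (a + b) c
  have h4 := val_add_add_carry a b
  rw [← add_assoc] at h2
  refine Nat.eq_of_mul_eq_mul_left (Nat.pos_of_neZero n) ?_
  rw [mul_add, mul_add]
  omega

/-- Adding 1 produces a carry only at `a = n - 1`. This is the nonzero value that detects the carry
class. -/
lemma sum_carry_one {n : ℕ} (hn : 1 < n) :
    ∑ a ∈ Finset.range n, carry n (a : ZMod n) 1 = 1 := by
  obtain ⟨m, rfl⟩ : ∃ m, n = m + 1 := ⟨n - 1, by omega⟩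
  have : Fact (1 < m + 1) := ⟨hn⟩
  rw [Finset.sum_range_succ, Finset.sum_eq_zero, zero_add, carry, ZMod.val_natCast_of_lt (by omega),
    ZMod.val_one, Nat.div_self (by omega)]
  intro a ha
  rw [Finset.mem_range] at ha
  rw [carry, ZMod.val_natCast_of_lt (by omega), ZMod.val_one]
  exact Nat.div_eq_of_lt (by omega)

namespace TrivCoh

lemma funD_two {k G : Type*} [CommRing k] [Group G] (f : (Fin 2 → G) → k) (a b c : G) :
    funD 2 f ![a, b, c] = f ![b, c] - f ![a * b, c] + f ![a, b * c] - f ![a, b] := by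
  have e1 : (Fin.tail ![a, b, c] : Fin 2 → G) = ![b, c] := by
    funext i; fin_cases i <;> rfl
  have e2 : (Fin.contractNth 0 (· * ·) ![a, b, c] : Fin 2 → G) = ![a * b, c] := by
    funext i; fin_cases i <;> rfl
  have e3 : (Fin.contractNth 1 (· * ·) ![a, b, c] : Fin 2 → G) = ![a, b * c] := by
    funext i; fin_cases i <;> rfl
  have e4 : (Fin.contractNth 2 (· * ·) ![a, b, c] : Fin 2 → G) = ![a, b] := by
    funext i; fin_cases i <;> rfl
  rw [funD, e1, Fin.sum_univ_three (f := fun j : Fin 3 => (-1 : k) ^ ((j : ℕ) + 1) *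
    f (Fin.contractNth (n := 2) j (· * ·) ![a, b, c])), e2, e3, e4]
  simp
  ring

variable {k G : Type*} [CommRing k] [Group G] [TopologicalSpace G] [IsTopologicalGroup G]

/-- The evaluation of two-cochains on the cycle `∑ₐ [gᵃ | g]`, for `a < n`. -/
def evalPowers (g : G) (n : ℕ) : Cochain k G 2 →ₗ[k] k where
  toFun f := ∑ a ∈ Finset.range n, f ![g ^ a, g]
  map_add' f h := by simp [Finset.sum_add_distrib]
  map_smul' c f := by simp [Finset.mul_sum]

lemma evalPowers_apply (g : G) (n : ℕ) (f : Cochain k G 2) :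
    evalPowers g n f = ∑ a ∈ Finset.range n, f ![g ^ a, g] := rfl

/-- The sum telescopes to `n h(g) - h(gⁿ) + h(1)`. -/
lemma evalPowers_d {g : G} {n : ℕ} (hg : g ^ n = 1) (hn : (n : k) = 0) (h : Cochain k G 1) :
    evalPowers g n (d k G 1 h) = 0 := by
  rw [evalPowers_apply]
  have e : ∀ a : ℕ, d k G 1 h ![g ^ a, g] =
      evalOne h g - (evalOne h (g ^ (a + 1)) - evalOne h (g ^ a)) := by
    intro a
    rw [coe_d, funD_one, pow_succ]
    simp only [evalOne_apply, Matrix.cons_val_zero, Matrix.cons_val_one]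
    ring
  rw [Finset.sum_congr rfl fun a _ => e a, Finset.sum_sub_distrib,
    Finset.sum_range_sub (fun a => evalOne h (g ^ a))]
  simp [hg, hn]

lemma evalOne_pow {f : Cochain k G 1} (hf : f ∈ cocycles k G 1) (g : G) (a : ℕ) :
    evalOne f (g ^ a) = a * evalOne f g := by
  have h1 : evalOne f (1 : G) = 0 := by simpa using evalOne_mul hf 1 1
  induction a with
  | zero => simp [h1]
  | succ a ih =>
    rw [pow_succ, evalOne_mul hf, ih]
    push_cast
    ring

/-- For a character `f`, the `a`-th term is `f(gᵃ) h(g) = a f(g) h(g)`, so the value is a multiple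
of `∑ a`. -/
lemma evalPowers_cup {g : G} {n : ℕ} (hn : ((∑ a ∈ Finset.range n, a : ℕ) : k) = 0)
    {f h : Cochain k G 1} (hf : f ∈ cocycles k G 1) :
    evalPowers g n (cupCochain k G 1 1 f h) = 0 := by
  rw [evalPowers_apply]
  have e : ∀ a : ℕ, cupCochain k G 1 1 f h ![g ^ a, g] = a * (evalOne f g * evalOne h g) := by
    intro a
    rw [cupCochain_one_one_apply]
    simp only [Matrix.cons_val_zero, Matrix.cons_val_one]
    rw [evalOne_pow hf]
    ring
  rw [Finset.sum_congr rfl fun a _ => e a, ← Finset.sum_mul, ← Nat.cast_sum, hn, zero_mul]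

/-- If the cohomology algebra is quadratic, then two-cocycles vanish on the cycles `∑ₐ [gᵃ | g]` on
which products of characters vanish. -/
lemma evalPowers_eq_zero_of_isQuadraticAlgebra (hq : IsQuadraticAlgebra k (H k G)) {g : G} {n : ℕ}
    (hg : g ^ n = 1) (hn : (n : k) = 0) (hn' : ((∑ a ∈ Finset.range n, a : ℕ) : k) = 0)
    {f : Cochain k G 2} (hf : f ∈ cocycles k G 2) : evalPowers g n f = 0 := by
  let E : H k G 2 →ₗ[k] k := Submodule.liftQ _ ((evalPowers g n).domRestrict (cocycles k G 2)) (by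
    rintro z ⟨h, hz⟩
    change evalPowers g n z.1 = 0
    rw [show z.1 = d k G 1 h from hz.symm, evalPowers_d hg hn])
  have hE : ∀ z, E (mk k G 2 z) = evalPowers g n z.1 := fun _ => rfl
  let L : (⨁ n, H k G n) →ₗ[k] k := E ∘ₗ DirectSum.component k ℕ (H k G) 2
  have hL : LinearMap.range (DirectSum.lof k ℕ (H k G) 1) ^ 2 ≤ LinearMap.ker L := by
    rw [pow_two, Submodule.mul_le]
    rintro _ ⟨a, rfl⟩ _ ⟨b, rfl⟩
    obtain ⟨a, rfl⟩ := mk_surjective 1 a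
    obtain ⟨b, rfl⟩ := mk_surjective 1 b
    rw [lof_mul_lof, LinearMap.mem_ker, LinearMap.comp_apply]
    rw [DirectSum.component.lof_self, cup_mk]
    exact evalPowers_cup hn' a.2
  rw [hq.range_lof_one_pow] at hL
  have := hL (LinearMap.mem_range_self _ (mk k G 2 ⟨f, hf⟩))
  rw [LinearMap.mem_ker, LinearMap.comp_apply, DirectSum.component.lof_self] at this
  exact this

/-- The pullback of the carry cocycle along a character. -/
lemma carry_mem_cocycles [DiscreteTopology G] {n : ℕ} [NeZero n] (π : G →* Multiplicative (ZMod n)) :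
    ofFun 2 (fun x => (carry n (π (x 0)).toAdd (π (x 1)).toAdd : k)) ∈ cocycles k G 2 := by
  rw [mem_cocycles_iff]
  funext x
  have hx : x = ![x 0, x 1, x 2] := by
    funext i; fin_cases i <;> rfl
  rw [hx, coe_ofFun, funD_two]
  have := congrArg (Nat.cast : ℕ → k)
    (carry_cocycle (π (x 0)).toAdd (π (x 1)).toAdd (π (x 2)).toAdd)
  push_cast at this
  simp only [Matrix.cons_val_zero, Matrix.cons_val_one, map_mul, toAdd_mul, Pi.zero_apply]
  linear_combination this

end TrivCoh

/-- A finite abelian `2`-group with quadratic cohomology is elementary abelian. -/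
theorem isElementaryAbelian_of_isHQuadratic (G : Type*) [Group G] [TopologicalSpace G]
    [IsTopologicalGroup G] [DiscreteTopology G] [Finite G] (h2 : IsPGroup 2 G)
    (hcomm : ∀ a b : G, a * b = b * a) (hq : IsHQuadratic 2 G) : IsElementaryAbelian 2 G := by
  refine ⟨hcomm, ?_⟩
  open TrivCoh in
  let _ : CommGroup G := { (inferInstance : Group G) with mul_comm := hcomm }
  obtain ⟨ι, _, n, hn, ⟨e⟩⟩ := CommGroup.equiv_prod_multiplicative_zmod_of_finite G
  classical
  have hn2 : ∀ i, n i = 2 := by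
    intro i
    have := hn i
    have : NeZero (n i) := ⟨by omega⟩
    -- Inclusion of a cyclic factor and the projection onto it; the carry cocycle is pulled back
    -- along `π` and tested on the generator `g` of the factor.
    let s : Multiplicative (ZMod (n i)) →* G :=
      e.symm.toMonoidHom.comp (MonoidHom.mulSingle (fun j => Multiplicative (ZMod (n j))) i)
    let π : G →* Multiplicative (ZMod (n i)) :=
      (Pi.evalMonoidHom (fun j => Multiplicative (ZMod (n j))) i).comp e.toMonoidHom
    have hπs : ∀ c, π (s c) = c := fun c => by simp [π, s]
    let g := s (Multiplicative.ofAdd 1)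
    have hg : g ^ n i = 1 := by
      rw [← map_pow, ← ofAdd_nsmul]
      simp
    have hπg : ∀ a : ℕ, (π (g ^ a)).toAdd = (a : ZMod (n i)) := fun a => by
      rw [map_pow, hπs, ← ofAdd_nsmul]
      simp
    obtain ⟨m, hm⟩ := h2 g
    have hdvd : n i ∣ 2 ^ m := by
      have := hπg (2 ^ m)
      rw [hm, map_one, toAdd_one] at this
      exact (ZMod.natCast_eq_zero_iff _ _).1 this.symm
    obtain ⟨l, -, hl⟩ := (Nat.dvd_prime_pow Nat.prime_two).1 hdvd
    match l, hl with
    | 0, hl => omega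
    | 1, hl => simpa using hl
    | l + 2, hl =>
      exfalso
      have h4 : n i = 4 * 2 ^ l := by rw [hl, pow_add]; ring
      have hz : ((n i : ℕ) : ZMod 2) = 0 := by
        rw [ZMod.natCast_eq_zero_iff]
        omega
      -- The sum is `n(n-1)/2`. Here divisibility of `n` by 4 enters: for `n = 2` the sum is 1, and
      -- products of characters would be detected.
      have hs : ((∑ a ∈ Finset.range (n i), a : ℕ) : ZMod 2) = 0 := by
        rw [ZMod.natCast_eq_zero_iff, Finset.sum_range_id, h4,
          show 4 * 2 ^ l * (4 * 2 ^ l - 1) = 2 * (2 * 2 ^ l * (4 * 2 ^ l - 1)) by ring,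
          Nat.mul_div_cancel_left _ two_pos, mul_assoc]
        exact dvd_mul_right _ _
      have h0 := evalPowers_eq_zero_of_isQuadraticAlgebra hq hg hz hs (carry_mem_cocycles π)
      rw [evalPowers_apply] at h0
      have h1 : ∀ a : ℕ, (ofFun 2 (fun x => (carry (n i) (π (x 0)).toAdd (π (x 1)).toAdd : ZMod 2)) :
          Cochain (ZMod 2) G 2) ![g ^ a, g] = (carry (n i) (a : ZMod (n i)) 1 : ℕ) := by
        intro a
        have := hπg 1
        rw [pow_one, Nat.cast_one] at this
        rw [coe_ofFun]
        simp only [Matrix.cons_val_zero, Matrix.cons_val_one]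
        rw [hπg, this]
      rw [Finset.sum_congr rfl fun a _ => h1 a, ← Nat.cast_sum, sum_carry_one (hn i)] at h0
      simp at h0
  intro a
  apply e.injective
  funext i
  rw [map_pow, map_one, Pi.pow_apply, Pi.one_apply]
  have := hn2 i
  generalize e a i = c
  revert c
  rw [this]
  decide

/-! ### The cohomology of finite cyclic groups does not vanish -/

namespace TrivCoh

section Cycle

variable {k C : Type*} [CommRing k] [Group C] [Fintype C]

/-- The evaluation of cochains on the cycle `∑ [a₁ | g | a₂ | g | ⋯ | aₘ | g]`. -/
def evalCycle (g : C) : (m : ℕ) → ((Fin (2 * m) → C) → k) →ₗ[k] k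
  | 0 => LinearMap.proj Fin.elim0
  | m + 1 => ∑ a : C, evalCycle g m ∘ₗ
      LinearMap.funLeft k k fun x : Fin (2 * m) → C =>
        (Fin.cons a (Fin.cons g x) : Fin (2 * m + 2) → C)

lemma evalCycle_succ (g : C) (m : ℕ) (f : (Fin (2 * m + 2) → C) → k) :
    evalCycle g (m + 1) f =
      ∑ a : C, evalCycle g m fun x => f (Fin.cons a (Fin.cons g x)) := by
  change (∑ a : C, evalCycle g m ∘ₗ LinearMap.funLeft k k fun x : Fin (2 * m) → C =>
        (Fin.cons a (Fin.cons g x) : Fin (2 * m + 2) → C)) f = _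
  rw [LinearMap.sum_apply]
  rfl

/-- Isolates the faces touching the first block `a, g`. The correction `- h(a, g, tail)` compensates
for the first face in the differential of the remaining variables. -/
lemma funD_cons_cons (n : ℕ) (h : (Fin (n + 2) → C) → k) (a g : C) (x : Fin (n + 1) → C) :
    funD (n + 2) h (Fin.cons a (Fin.cons g x)) =
      h (Fin.cons g x) - h (Fin.cons (a * g) x) + h (Fin.cons a (Fin.cons (g * x 0) (Fin.tail x)))
        - h (Fin.cons a (Fin.cons g (Fin.tail x)))
        + funD n (fun y => h (Fin.cons a (Fin.cons g y))) x := by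
  rw [funD, funD, Fin.sum_univ_succ, Fin.sum_univ_succ]
  simp only [contractNth_cons_succ, contractNth_cons_zero, Fin.tail_cons, Fin.cons_zero,
    Fin.val_succ, Fin.val_zero, pow_succ, pow_zero]
  simp only [mul_neg, mul_one, neg_neg, neg_mul, one_mul]
  ring

/-- The chain is a cycle. In the expansion of `funD_cons_cons`, translating the next summation
variable by `g` simplifies the third term, the fourth does not depend on that variable and is
multiplied by `|C| = 0`, and the fifth vanishes by induction. Summing over `a`, the first term is
again multiplied by `|C|`, and what remains cancels under `a ↦ a * g`. -/
lemma evalCycle_funD (hC : (Fintype.card C : k) = 0) (g : C) (m : ℕ)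
    (h : (Fin (2 * m + 1) → C) → k) : evalCycle g (m + 1) (funD (2 * m + 1) h) = 0 := by
  have hconst : ∀ c : k, ∑ _a : C, c = 0 := fun c => by
    rw [Finset.sum_const, Finset.card_univ, nsmul_eq_mul, hC, zero_mul]
  induction m with
  | zero =>
    rw [evalCycle_succ]
    have e : ∀ a : C, evalCycle g 0 (fun x => funD 1 h (Fin.cons a (Fin.cons g x))) =
        h (fun _ => g) - h (fun _ => a * g) + h (fun _ => a) := fun a => funD_one h _
    rw [Finset.sum_congr rfl fun a _ => e a, Finset.sum_add_distrib, Finset.sum_sub_distrib,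
      hconst]
    have h1 := Equiv.sum_comp (Equiv.mulRight g) fun a => h fun _ => a
    simp only [Equiv.coe_mulRight] at h1
    rw [h1]
    ring
  | succ m ih =>
    rw [evalCycle_succ]
    have e : ∀ a : C, evalCycle g (m + 1) (fun x =>
        funD (2 * (m + 1) + 1) h (Fin.cons a (Fin.cons g x))) =
        evalCycle g (m + 1) (fun x => h (Fin.cons g x)) -
          evalCycle g (m + 1) (fun x => h (Fin.cons (a * g) x)) +
          evalCycle g (m + 1) (fun x => h (Fin.cons a x)) := by
      intro a
      have e1 : (fun x : Fin (2 * m + 2) → C =>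
          funD (2 * (m + 1) + 1) h (Fin.cons a (Fin.cons g x))) =
          (fun x => h (Fin.cons g x)) - (fun x => h (Fin.cons (a * g) x)) +
          (fun x => h (Fin.cons a (Fin.cons (g * x 0) (Fin.tail x)))) -
          (fun x => h (Fin.cons a (Fin.cons g (Fin.tail x)))) +
          funD (2 * m + 1) (fun y => h (Fin.cons a (Fin.cons g y))) := by
        funext x
        exact funD_cons_cons _ _ _ _ _
      have e2 : evalCycle g (m + 1) (fun x : Fin (2 * m + 2) → C =>
          h (Fin.cons a (Fin.cons (g * x 0) (Fin.tail x)))) =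
          evalCycle g (m + 1) (fun x => h (Fin.cons a x)) := by
        rw [evalCycle_succ, evalCycle_succ,
          ← Equiv.sum_comp (Equiv.mulLeft g) fun b => evalCycle g m fun x : Fin (2 * m) → C =>
            h (Fin.cons a (Fin.cons b (Fin.cons g x)))]
        rfl
      have e3 : evalCycle g (m + 1) (fun x : Fin (2 * m + 2) → C =>
          h (Fin.cons a (Fin.cons g (Fin.tail x)))) = 0 := by
        rw [evalCycle_succ]
        simp only [Fin.tail_cons]
        exact hconst _
      rw [show evalCycle g (m + 1) (fun x : Fin (2 * (m + 1)) → C =>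
          funD (2 * (m + 1) + 1) h (Fin.cons a (Fin.cons g x))) = _ from congrArg _ e1]
      erw [map_add, map_sub, map_add, map_sub, e2, e3, ih]
      ring
    rw [Finset.sum_congr rfl fun a _ => e a, Finset.sum_add_distrib, Finset.sum_sub_distrib,
      hconst]
    have h1 := Equiv.sum_comp (Equiv.mulRight g) fun a =>
        evalCycle g (m + 1) (fun x => h (Fin.cons a x))
    simp only [Equiv.coe_mulRight] at h1
    rw [h1]
    ring

end Cycle

lemma castCochain_mem_cocycles {k G : Type*} [CommRing k] [Group G] [TopologicalSpace G]
    [IsTopologicalGroup G] {m n : ℕ} (e : m = n) {f : Cochain k G m} (hf : f ∈ cocycles k G m) :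
    castCochain e f ∈ cocycles k G n := by
  subst e; exact hf

/-- In even degrees, finite cyclic groups have cocycles that are not coboundaries. -/
lemma exists_cocycle_of_isCyclic {k C : Type*} [CommRing k] [Nontrivial k] [Group C] [Finite C]
    [IsCyclic C] [Nontrivial C] (hC : (Nat.card C : k) = 0) (m : ℕ) :
    ∃ f : (Fin (2 * m + 1 + 1) → C) → k, funD (2 * m + 1 + 1) f = 0 ∧
      ∀ h, f ≠ funD (2 * m + 1) h := by
  have := Fintype.ofFinite C
  let _ : TopologicalSpace C := ⊥
  have : DiscreteTopology C := ⟨rfl⟩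
  have hcard : 1 < Nat.card C := Finite.one_lt_card
  have : NeZero (Nat.card C) := ⟨by omega⟩
  let ψ : C ≃* Multiplicative (ZMod (Nat.card C)) := (zmodCyclicMulEquiv ‹_›).symm
  let g : C := ψ.symm (Multiplicative.ofAdd 1)
  let β : Cochain k C 2 := ofFun 2 fun x => (carry (Nat.card C) (ψ (x 0)).toAdd (ψ (x 1)).toAdd : k)
  have hβ : β ∈ cocycles k C 2 := carry_mem_cocycles ψ.toMonoidHom
  have hsum : ∑ a : C, β ![a, g] = 1 := by
    have h1 := congrArg (Nat.cast : ℕ → k) (sum_carry_one hcard)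
    rw [Nat.cast_one, Nat.cast_sum] at h1
    rw [← h1]
    refine Finset.sum_nbij' (fun c => (ψ c).toAdd.val) (fun a => ψ.symm (Multiplicative.ofAdd a))
      (fun c _ => Finset.mem_range.2 (ZMod.val_lt _)) (fun _ _ => Finset.mem_univ _)
      (fun c _ => by simp) (fun a ha => ?_) fun c _ => ?_
    · simp [ZMod.val_natCast_of_lt (Finset.mem_range.1 ha)]
    · rw [ZMod.natCast_zmod_val]
      simp [β, g]
  have key : ∀ m, ∃ f ∈ cocycles k C (2 * m), evalCycle g m f = 1 := by
    intro m
    induction m with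
    | zero => exact ⟨ofFun 0 1, d_zero _, rfl⟩
    | succ m ih =>
      obtain ⟨f, hf, hf1⟩ := ih
      -- The cocycle is a power of the carry class: evaluation on the cycle is multiplicative for
      -- left products with `β`, and `β` contributes the factor 1.
      refine ⟨castCochain (add_comm 2 (2 * m)) (cupCochain k C 2 (2 * m) β f),
        castCochain_mem_cocycles _ (cup_mem_cocycles hβ hf), ?_⟩
      rw [evalCycle_succ]
      have e : ∀ a : C, (fun x : Fin (2 * m) → C =>
          castCochain (add_comm 2 (2 * m)) (cupCochain k C 2 (2 * m) β f)
            (Fin.cons a (Fin.cons g x))) = β ![a, g] • ⇑f := by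
        intro a
        funext x
        rw [castCochain_apply, cupCochain_apply, Pi.smul_apply, smul_eq_mul]
        congr 2
        · funext i
          fin_cases i <;> rfl
        · funext i
          have : Fin.cast (add_comm 2 (2 * m)) (Fin.natAdd 2 i) = i.succ.succ := by
            ext; simp
          rw [this]
          rfl
      simp only [e, map_smul, hf1, smul_eq_mul, mul_one]
      exact hsum
  obtain ⟨f, hf, hf1⟩ := key (m + 1)
  refine ⟨f, mem_cocycles_iff.1 hf, fun h hfh => ?_⟩
  have h0 := evalCycle_funD (k := k) (by rwa [← Nat.card_eq_fintype_card]) g m h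
  rw [← hfh, hf1] at h0
  exact one_ne_zero h0

end TrivCoh

/-! ### Twisted coefficients -/

namespace TrivCoh

section Twisted

variable {k G Q V : Type*} [Field k] [Group G] [Group Q] [AddCommGroup V] [Module k V]

/-- The differential of inhomogeneous cochains of `G` with values in a representation of a
quotient `π : G → Q`. -/
def twistedD (π : G →* Q) (ρ : Representation k Q V) (n : ℕ) :
    ((Fin n → G) → V) →ₗ[k] ((Fin (n + 1) → G) → V) where
  toFun f x := ρ (π (x 0)) (f (Fin.tail x)) +
    ∑ j : Fin (n + 1), (-1 : k) ^ ((j : ℕ) + 1) • f (Fin.contractNth j (· * ·) x)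
  map_add' f g := by
    funext x
    simp only [Pi.add_apply, map_add, smul_add, Finset.sum_add_distrib]
    abel
  map_smul' c f := by
    funext x
    simp only [Pi.smul_apply, map_smul, RingHom.id_apply, smul_add, Finset.smul_sum,
      smul_comm c]

lemma twistedD_apply (π : G →* Q) (ρ : Representation k Q V) (n : ℕ) (f : (Fin n → G) → V)
    (x : Fin (n + 1) → G) : twistedD π ρ n f x = ρ (π (x 0)) (f (Fin.tail x)) +
      ∑ j : Fin (n + 1), (-1 : k) ^ ((j : ℕ) + 1) • f (Fin.contractNth j (· * ·) x) := rfl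

/-- For a functional `l`, the homogeneous cochain `l (ρ (π q) (f y))` turns the twisted differential
into `homD`, whose square is zero; functionals separate the points of `V`. -/
lemma twistedD_twistedD (π : G →* Q) (ρ : Representation k Q V) (n : ℕ) (f : (Fin n → G) → V) :
    twistedD π ρ (n + 1) (twistedD π ρ n f) = 0 := by
  have key : ∀ (l : Module.Dual k V) (n : ℕ) (f : (Fin n → G) → V),
      homD n (fun q y => l (ρ (π q) (f y))) = fun q x => l (ρ (π q) (twistedD π ρ n f x)) := by
    intro l n f
    funext q x
    simp [homD_apply, twistedD_apply, map_sum]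
  funext x
  refine (Module.forall_dual_apply_eq_zero_iff k _).1 fun l => ?_
  have h := homD_homD n (fun q y => l (ρ (π q) (f y)))
  rw [key, key] at h
  simpa using congrFun (congrFun h 1) x

/-- A nonzero representation of a finite `p`-group over `𝔽_p` has a nonzero invariant
functional. -/
lemma exists_invariant_functional {p : ℕ} [Fact p.Prime] {Q V : Type*} [Group Q] [Finite Q]
    (hQ : IsPGroup p Q) [AddCommGroup V] [Module (ZMod p) V] [Module.Finite (ZMod p) V]
    [Nontrivial V] (ρ : Representation (ZMod p) Q V) :
    ∃ l : Module.Dual (ZMod p) V, l ≠ 0 ∧ ∀ q v, l (ρ q v) = l v := by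
  let _ : MulAction Q (Module.Dual (ZMod p) V) :=
    { smul := fun q l => l ∘ₗ ρ q⁻¹
      one_smul := fun l => by
        change l ∘ₗ ρ 1⁻¹ = l
        rw [inv_one, map_one]; rfl
      mul_smul := fun a b l => by
        change l ∘ₗ ρ (a * b)⁻¹ = (l ∘ₗ ρ b⁻¹) ∘ₗ ρ a⁻¹
        rw [mul_inv_rev, map_mul]; rfl }
  have hsmul : ∀ (q : Q) (l : Module.Dual (ZMod p) V) (v : V), (q • l) v = l (ρ q⁻¹ v) :=
    fun _ _ _ => rfl
  have : Finite (Module.Dual (ZMod p) V) := Module.finite_of_finite (ZMod p)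
  -- Fixed points of a `p`-group are counted modulo `p`: since 0 is fixed in the dual space, there
  -- is a second fixed point.
  have hcard : p ∣ Nat.card (Module.Dual (ZMod p) V) := by
    rw [Module.natCard_eq_pow_finrank (K := ZMod p), Nat.card_zmod, Subspace.dual_finrank_eq]
    exact dvd_pow_self p (Module.finrank_pos (R := ZMod p) (M := V)).ne'
  obtain ⟨l, hl, hl0⟩ := hQ.exists_fixed_point_of_prime_dvd_card_of_fixed_point
    (Module.Dual (ZMod p) V) hcard (a := 0) (fun q => by ext v; rw [hsmul]; rfl)
  refine ⟨l, hl0.symm, fun q v => ?_⟩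
  have h := LinearMap.congr_fun (hl q⁻¹) v
  rwa [hsmul, inv_inv] at h

end Twisted

lemma isLocallyConstant_twistedD {k G Q V : Type*} [Field k] [Group G] [TopologicalSpace G]
    [IsTopologicalGroup G] [Group Q] [TopologicalSpace Q] [DiscreteTopology Q] {π : G →* Q}
    (hπ : Continuous π) [AddCommGroup V] [Module k V] (ρ : Representation k Q V) (n : ℕ)
    {f : (Fin n → G) → V} (hf : IsLocallyConstant f) : IsLocallyConstant (twistedD π ρ n f) := by
  let _ : TopologicalSpace V := ⊥
  have : DiscreteTopology V := ⟨rfl⟩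
  rw [IsLocallyConstant.iff_continuous] at hf ⊢
  refine Continuous.add ?_ (continuous_finsetSum _ fun j _ => ?_)
  · have h1 : Continuous fun x : Fin (n + 1) → G => π (x 0) := by fun_prop
    have h2 : Continuous fun x : Fin (n + 1) → G => f (Fin.tail x) :=
      hf.comp (tailMap G n).continuous
    exact (continuous_of_discreteTopology (f := fun y : Q × V => ρ y.1 y.2)).comp (h1.prodMk h2)
  · exact (continuous_of_discreteTopology (f := fun v : V => (-1 : k) ^ ((j : ℕ) + 1) • v)).comp
      (hf.comp (contractMap G n j).continuous)

/-- If the cohomology of `G` with trivial coefficients `𝔽_p` vanishes in degree `n + 1`, then so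
does its cohomology with coefficients in any finite representation of a finite quotient
`p`-group. -/
lemma exists_eq_twistedD {p : ℕ} [Fact p.Prime] {G Q : Type*} [Group G] [TopologicalSpace G]
    [IsTopologicalGroup G] [Group Q] [Finite Q] [TopologicalSpace Q] [DiscreteTopology Q]
    (hQ : IsPGroup p Q) {π : G →* Q} (hπ : Continuous π) {n : ℕ}
    (hn : ∀ f ∈ cocycles (ZMod p) G (n + 1), f ∈ coboundaries (ZMod p) G (n + 1))
    {V : Type*} [AddCommGroup V] [Module (ZMod p) V] [Module.Finite (ZMod p) V]
    (ρ : Representation (ZMod p) Q V) (f : (Fin (n + 1) → G) → V) (hf : IsLocallyConstant f)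
    (hf0 : twistedD π ρ (n + 1) f = 0) :
    ∃ g : (Fin n → G) → V, IsLocallyConstant g ∧ f = twistedD π ρ n g := by
  induction hr : Module.finrank (ZMod p) V using Nat.strong_induction_on generalizing V with
  | _ r ih =>
    rcases subsingleton_or_nontrivial V with hV | hV
    · exact ⟨0, IsLocallyConstant.const 0, funext fun x => Subsingleton.elim _ _⟩
    obtain ⟨l, hl0, hl⟩ := exists_invariant_functional hQ ρ
    have hlD : ∀ (m : ℕ) (f : (Fin m → G) → V) (x : Fin (m + 1) → G),
        l (twistedD π ρ m f x) = funD m (fun y => l (f y)) x := by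
      intro m f x
      simp [twistedD_apply, funD, hl, map_sum]
    -- The composite of `f` with `l` is a cocycle with trivial coefficients, hence some `d g`.
    -- Subtracting the coboundary of `g • v` moves `f` into the kernel of `l`, a subrepresentation
    -- of smaller dimension.
    obtain ⟨v, hv⟩ : ∃ v, l v = 1 := LinearMap.surjective_of_ne_zero hl0 1
    obtain ⟨g, hg⟩ : (⟨fun x => l (f x), hf.comp l⟩ : Cochain (ZMod p) G (n + 1)) ∈
        coboundaries (ZMod p) G (n + 1) := by
      refine hn _ (mem_cocycles_iff.2 (funext fun x => ?_))
      change funD (n + 1) (fun y => l (f y)) x = 0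
      rw [← hlD, hf0, Pi.zero_apply, map_zero]
    have hg' : ∀ x, funD n g x = l (f x) := fun x => by
      rw [← coe_d, hg]; rfl
    have hgv : IsLocallyConstant fun x => g x • v := g.isLocallyConstant.comp (· • v)
    have hdiff : ∀ x, (f - twistedD π ρ n fun x => g x • v) x ∈ LinearMap.ker l := by
      intro x
      rw [LinearMap.mem_ker, Pi.sub_apply, map_sub, hlD]
      simp [hv, hg']
    let ρ' : Representation (ZMod p) Q (LinearMap.ker l) :=
      { toFun := fun q => (ρ q).restrict fun w hw => by
          rw [LinearMap.mem_ker] at *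
          rw [hl, hw]
        map_one' := by ext; simp
        map_mul' := fun a b => by ext; simp }
    let f' : (Fin (n + 1) → G) → LinearMap.ker l := fun x => ⟨_, hdiff x⟩
    have hf' : IsLocallyConstant f' := by
      refine IsLocallyConstant.desc _ Subtype.val ?_ Subtype.val_injective
      exact hf.sub (isLocallyConstant_twistedD hπ ρ n hgv)
    have hcoe : ∀ (m : ℕ) (e : (Fin m → G) → LinearMap.ker l) (x : Fin (m + 1) → G),
        (twistedD π ρ' m e x : V) = twistedD π ρ m (fun y => e y) x := by
      intro m e x
      simp [twistedD_apply, ρ']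
    have hf0' : twistedD π ρ' (n + 1) f' = 0 := by
      funext x
      apply Subtype.ext
      rw [hcoe]
      change twistedD π ρ (n + 1) (f - twistedD π ρ n fun x => g x • v) x = 0
      rw [map_sub, hf0, twistedD_twistedD, sub_zero, Pi.zero_apply]
    have hlt : Module.finrank (ZMod p) (LinearMap.ker l) < r := by
      rw [← hr]
      refine Submodule.finrank_lt fun h => hl0 (LinearMap.ker_eq_top.1 h)
    obtain ⟨e, he, hfe⟩ := ih _ hlt ρ' f' hf' hf0' rfl
    refine ⟨(fun x => g x • v) + fun x => (e x : V), hgv.add (he.comp Subtype.val), ?_⟩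
    funext x
    have h1 := congrArg Subtype.val (congrFun hfe x)
    rw [hcoe] at h1
    rw [map_add, Pi.add_apply, ← h1]
    simp [f']

/-! ### Coinduction -/

section Coinduction

variable {k C Q : Type*} [Field k] [Group C] [Group Q] (s : C →* Q) (e : Q → C)

/-- For a `C`-equivariant map `e : Q → C`, the sequence of the differences of the values of `e`
at the points `q, x₁⁻¹ q, x₂⁻¹ x₁⁻¹ q, …`. -/
def differences : {n : ℕ} → Q → (Fin n → Q) → (Fin n → C)
  | 0, _, _ => Fin.elim0
  | _ + 1, q, x => Fin.cons (e q * (e ((x 0)⁻¹ * q))⁻¹) (differences ((x 0)⁻¹ * q) (Fin.tail x))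

lemma differences_succ {n : ℕ} (q : Q) (x : Fin (n + 1) → Q) :
    differences e q x =
      Fin.cons (e q * (e ((x 0)⁻¹ * q))⁻¹) (differences e ((x 0)⁻¹ * q) (Fin.tail x)) := rfl

/-- Adjacent entries have the form `u v⁻¹` and `v w⁻¹`, so their products telescope. Composing with
`differences` thus turns cocycles of `C` into twisted cocycles on `Q`. -/
lemma differences_contractNth {n : ℕ} (q : Q) (x : Fin (n + 1) → Q) (j : Fin (n + 1)) :
    differences e q (Fin.contractNth j (· * ·) x) =
      Fin.contractNth j (· * ·) (differences e q x) := by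
  induction n generalizing q with
  | zero => exact Subsingleton.elim _ _
  | succ n ih =>
    obtain ⟨y, z, rfl⟩ : ∃ y z, x = Fin.cons y z := ⟨x 0, Fin.tail x, (Fin.cons_self_tail x).symm⟩
    refine Fin.cases ?_ (fun j => ?_) j
    · rw [contractNth_cons_zero, differences_succ, differences_succ, contractNth_cons_zero,
        differences_succ]
      simp [mul_assoc]
    · rw [contractNth_cons_succ, differences_succ, differences_succ, contractNth_cons_succ, ← ih]
      simp

variable {s e} (he : ∀ q c, e (q * s c) = e q * c)
include he

/-- Right translation multiplies all values of `e` by the same `c`, which cancels in `u v⁻¹`. -/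
lemma differences_mul {n : ℕ} (q : Q) (c : C) (x : Fin n → Q) :
    differences e (q * s c) x = differences e q x := by
  induction n generalizing q with
  | zero => rfl
  | succ n ih =>
    rw [differences_succ, differences_succ, ← mul_assoc, he, he, ih]
    simp [mul_assoc]

lemma differences_comp (h1 : e 1 = 1) {n : ℕ} (c : Fin n → C) :
    differences e 1 (s ∘ c) = c := by
  induction n with
  | zero => exact Subsingleton.elim _ _
  | succ n ih =>
    have h2 : ((s ∘ c) 0)⁻¹ * 1 = 1 * s (c 0)⁻¹ := by simp
    rw [differences_succ, h2, he, differences_mul he, h1,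
      show Fin.tail (s ∘ c) = s ∘ Fin.tail c from rfl, ih]
    simp

omit he

variable (k s) in
/-- The functions on `Q` that are invariant under right translation by `C`. -/
def rightInvariant : Submodule k (Q → k) where
  carrier := {φ | ∀ q c, φ (q * s c) = φ q}
  zero_mem' _ _ := rfl
  add_mem' hφ hψ q c := congrArg₂ (· + ·) (hφ q c) (hψ q c)
  smul_mem' a _ hφ q c := congrArg (a * ·) (hφ q c)

variable (k s) in
/-- The representation of `Q` that is coinduced from the trivial representation of `C`. -/
def coinducedRep : Representation k Q (rightInvariant k s) where
  toFun q :=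
    { toFun := fun φ => ⟨fun y => φ.1 (q⁻¹ * y), fun y c => by
        simpa only [mul_assoc] using φ.2 (q⁻¹ * y) c⟩
      map_add' := fun _ _ => rfl
      map_smul' := fun _ _ => rfl }
  map_one' := by
    ext φ y
    simp
  map_mul' a b := by
    ext φ y
    simp [mul_assoc]

lemma coinducedRep_apply (q : Q) (φ : rightInvariant k s) (y : Q) :
    (coinducedRep k s q φ).1 y = φ.1 (q⁻¹ * y) := rfl

/-- Write each `q` as a coset representative times `s (e q)`, then normalise by `(e 1)⁻¹` on the
left. -/
lemma exists_equivariant (hs : Function.Injective s) :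
    ∃ e : Q → C, (∀ q c, e (q * s c) = e q * c) ∧ e 1 = 1 := by
  have h : ∀ q : Q, ∃ c : C, q = (q : Q ⧸ s.range).out * s c := by
    intro q
    have : ((q : Q ⧸ s.range).out)⁻¹ * q ∈ s.range := by
      rw [← QuotientGroup.eq]
      exact QuotientGroup.out_eq' _
    obtain ⟨c, hc⟩ := this
    exact ⟨c, by rw [hc, mul_inv_cancel_left]⟩
  choose e he using h
  have hmul : ∀ q c, e (q * s c) = e q * c := by
    intro q c
    have h1 : ((q * s c : Q) : Q ⧸ s.range) = (q : Q ⧸ s.range) := by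
      rw [QuotientGroup.eq]
      exact ⟨c⁻¹, by simp⟩
    have h2 := he (q * s c)
    rw [h1] at h2
    nth_rewrite 1 [he q] at h2
    rw [mul_assoc] at h2
    apply hs
    rw [map_mul]
    exact (mul_left_cancel h2).symm
  exact ⟨fun q => (e 1)⁻¹ * e q, fun q c => by simp only [hmul, mul_assoc], inv_mul_cancel _⟩

end Coinduction

/-- If the cohomology of `G` with coefficients `𝔽_p` vanishes in degree `n + 1`, then so does the
cohomology of every subgroup `C` that embeds into a finite quotient `p`-group of `G`. -/
lemma exists_eq_funD_of_injective {p : ℕ} [Fact p.Prime] {G Q C : Type*} [Group G]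
    [TopologicalSpace G] [IsTopologicalGroup G] [Group Q] [Finite Q] [TopologicalSpace Q]
    [DiscreteTopology Q] [Group C] (hQ : IsPGroup p Q) {π : G →* Q} (hπ : Continuous π) (t : C →* G)
    (ht : Function.Injective (π.comp t)) {n : ℕ}
    (hn : ∀ f ∈ cocycles (ZMod p) G (n + 1), f ∈ coboundaries (ZMod p) G (n + 1))
    (f : (Fin (n + 1) → C) → ZMod p) (hf : funD (n + 1) f = 0) : ∃ h, f = funD n h := by
  obtain ⟨e, he, h1⟩ := exists_equivariant ht
  -- The Shapiro cocycle of `f`, inflated from `Q` to `G`. Restricting to `C` and evaluating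
  -- functions at 1, which is a `C`-invariant functional on the coinduced module, gives back `f`; so
  -- a primitive of `φ` yields one of `f`.
  let φ : (Fin (n + 1) → G) → rightInvariant (ZMod p) (π.comp t) := fun x =>
    ⟨fun q => f (differences e q (π ∘ x)), fun q c => congrArg f (differences_mul he q c _)⟩
  have hφ : IsLocallyConstant φ := by
    let φ' : (Fin (n + 1) → Q) → rightInvariant (ZMod p) (π.comp t) := fun x =>
      ⟨fun q => f (differences e q x), fun q c => congrArg f (differences_mul he q c _)⟩
    exact (IsLocallyConstant.of_discrete φ').comp_continuous
      (f := fun x : Fin (n + 1) → G => (π ∘ x : Fin (n + 1) → Q)) (by fun_prop)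
  have hφ0 : twistedD π (coinducedRep (ZMod p) (π.comp t)) (n + 1) φ = 0 := by
    funext x
    apply Subtype.ext
    funext q
    have h := congrFun hf (differences e q (π ∘ x))
    rw [funD] at h
    simp only [← differences_contractNth, ← comp_contractNth] at h
    rw [twistedD_apply]
    have h' : Fin.tail (differences e q (π ∘ x)) =
        differences e ((π (x 0))⁻¹ * q) (π ∘ Fin.tail x) := rfl
    rw [h'] at h
    simpa [coinducedRep_apply, φ] using h
  obtain ⟨g, -, hg⟩ := exists_eq_twistedD hQ hπ hn _ φ hφ hφ0
  refine ⟨fun c => (g (t ∘ c)).1 1, funext fun c => ?_⟩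
  have h2 := congrFun (congrArg Subtype.val (congrFun hg (t ∘ c))) 1
  have h3 : (φ (t ∘ c)).1 1 = f c := congrArg f (differences_comp he h1 c)
  have h4 : (g (Fin.tail (t ∘ c))).1 ((π (t (c 0)))⁻¹ * 1) = (g (t ∘ Fin.tail c)).1 1 := by
    have := (g (t ∘ Fin.tail c)).2 1 (c 0)⁻¹
    rw [show Fin.tail (t ∘ c) = t ∘ Fin.tail c from rfl]
    simpa using this
  rw [← h3, h2, twistedD_apply, funD]
  simp only [← comp_contractNth]
  rw [← h4]
  simp [coinducedRep_apply]

end TrivCoh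

/-! ### Torsion in quadratic pro-`p` groups -/

open TrivCoh in
/-- The first cohomology of a topologically finitely generated group is finite-dimensional. -/
lemma finite_H_one {k G : Type*} [Field k] [Group G] [TopologicalSpace G] [IsTopologicalGroup G]
    (hG : IsTopFinGen G) : Module.Finite k (H k G 1) := by
  obtain ⟨S, hS, hcl⟩ := hG
  have := hS.to_subtype
  let ev : cocycles k G 1 →ₗ[k] (S → k) :=
    LinearMap.funLeft k k (Subtype.val : S → G) ∘ₗ evalOne ∘ₗ (cocycles k G 1).subtype
  have hev : Function.Injective ev := by
    rw [← LinearMap.ker_eq_bot, LinearMap.ker_eq_bot']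
    intro z hz
    have hz' : ∀ g ∈ S, evalOne z.1 g = 0 := fun g hg => congrFun hz ⟨g, hg⟩
    -- The zero set of a continuous character is a closed subgroup, so a character is determined by
    -- its values on topological generators.
    let K : Subgroup G :=
      { carrier := {g | evalOne z.1 g = 0}
        one_mem' := by simpa using evalOne_mul z.2 1 1
        mul_mem' := fun {a b} ha hb => by
          rw [Set.mem_ofPred_eq] at *
          rw [evalOne_mul z.2, ha, hb, add_zero]
        inv_mem' := fun {a} ha => by
          rw [Set.mem_ofPred_eq] at *
          have h1 : evalOne z.1 (1 : G) = 0 := by simpa using evalOne_mul z.2 1 1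
          have h2 := evalOne_mul z.2 a a⁻¹
          rw [mul_inv_cancel, h1, ha, zero_add] at h2
          exact h2.symm }
    have hK : IsClosed (K : Set G) := by
      have h1 : IsLocallyConstant fun g : G => evalOne z.1 g :=
        z.1.isLocallyConstant.comp_continuous (f := fun g : G => (fun _ => g : Fin 1 → G))
          (by fun_prop)
      exact h1.isClosed_fiber 0
    have htop : (⊤ : Subgroup G) ≤ K := by
      rw [← hcl]
      exact Subgroup.topologicalClosure_minimal _ ((Subgroup.closure_le K).2 hz') hK
    ext x
    have hx : evalOne z.1 (x 0) = 0 := htop (Subgroup.mem_top _)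
    rw [evalOne_apply, show (fun _ => x 0) = x from funext fun i => by
      rw [Subsingleton.elim i 0]] at hx
    exact hx
  have := Module.Finite.of_injective ev hev
  exact Module.Finite.of_surjective (mk k G 1) (mk_surjective 1)

open TrivCoh in
/-- For odd `p`, the cohomology of a topologically finitely generated quadratic group vanishes in
large degrees. -/
lemma exists_forall_cocycles_le_coboundaries {p : ℕ} [Fact p.Prime] (hp : Odd p) {G : Type*}
    [Group G] [TopologicalSpace G] [IsTopologicalGroup G] (hfg : IsTopFinGen G)
    (hq : IsHQuadratic p G) : ∃ d, ∀ n, d < n → ∀ f ∈ cocycles (ZMod p) G n,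
      f ∈ coboundaries (ZMod p) G n := by
  have := finite_H_one (k := ZMod p) hfg
  refine ⟨Module.finrank (ZMod p) (H (ZMod p) G 1), fun n hn f hf => ?_⟩
  have hsq : ∀ a : H (ZMod p) G 1, DirectSum.lof (ZMod p) ℕ (H (ZMod p) G) 1 a *
      DirectSum.lof (ZMod p) ℕ (H (ZMod p) G) 1 a = 0 := by
    intro a
    have h2 : (2 : ZMod p) ≠ 0 := by
      have := Fact.out (p := p.Prime)
      intro h
      rw [show (2 : ZMod p) = ((2 : ℕ) : ZMod p) by norm_cast, ZMod.natCast_eq_zero_iff] at h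
      have h3 := Nat.le_of_dvd two_pos h
      obtain rfl : p = 2 := le_antisymm h3 this.two_le
      exact absurd hp (by decide)
    have h := cup_one_one_add_swap a a
    have h' : (2 : ZMod p) • cup (ZMod p) G 1 1 a a = 0 := (two_smul _ _).trans h
    rw [lof_mul_lof, (smul_eq_zero.1 h').resolve_left h2, map_zero]
  have hbot := range_pow_eq_bot_of_sq_eq_zero (DirectSum.lof (ZMod p) ℕ (H (ZMod p) G) 1) hsq hn
  rw [IsQuadraticAlgebra.range_lof_one_pow hq, LinearMap.range_eq_bot] at hbot
  have h := LinearMap.congr_fun hbot (mk (ZMod p) G n ⟨f, hf⟩)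
  have h0 : mk (ZMod p) G n ⟨f, hf⟩ = 0 :=
    DirectSum.of_injective (β := H (ZMod p) G) n (h.trans (map_zero _).symm)
  exact (mk_eq_zero_iff _).1 h0

/-- For odd `p`, a finitely generated pro-`p` group with quadratic cohomology is torsion-free. -/
theorem eq_one_of_isOfFinOrder_of_isHQuadratic {p : ℕ} [Fact p.Prime] (hp : Odd p) {G : Type*}
    [Group G] [TopologicalSpace G] [IsTopologicalGroup G] (hG : IsProP p G)
    (hfg : IsTopFinGen G) (hq : IsHQuadratic p G) (g : G) (hg : IsOfFinOrder g) : g = 1 := by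
  by_contra hg1
  have := hG.compact
  have := hG.t2
  have := hG.totallyDisconnected
  obtain ⟨l, hl, hlg⟩ := Nat.exists_prime_and_dvd (n := orderOf g) (by rwa [Ne, orderOf_eq_one_iff])
  have : Fact l.Prime := ⟨hl⟩
  let c := g ^ (orderOf g / l)
  have hc : orderOf c = l := orderOf_pow_orderOf_div hg.orderOf_pos.ne' hlg
  have hc1 : c ≠ 1 := fun h => by
    rw [h, orderOf_one] at hc
    exact hl.one_lt.ne hc
  -- An open normal subgroup avoiding `c` meets the prime order group generated by `c` trivially, so
  -- that group embeds into the quotient.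
  obtain ⟨U, hU⟩ := ProfiniteGrp.exist_openNormalSubgroup_sub_open_nhds_of_one
    (isOpen_compl_singleton (x := c)) (by simpa using hc1.symm)
  have hcU : c ∉ (U : Subgroup G) := fun h => hU h rfl
  have hUo : IsOpen ((U : Subgroup G) : Set G) := U.isOpen'
  have hUn : (U : Subgroup G).Normal := U.isNormal'
  let π := QuotientGroup.mk' (U : Subgroup G)
  have hQ : IsPGroup p (G ⧸ (U : Subgroup G)) := hG.isPGroup _ hUo
  have hdisc : DiscreteTopology (G ⧸ (U : Subgroup G)) := QuotientGroup.discreteTopology hUo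
  have hfin : Finite (G ⧸ (U : Subgroup G)) := finite_of_compact_of_discrete
  have hπ : Continuous π := continuous_quotient_mk'
  let t := (Subgroup.zpowers c).subtype
  have hcard : Nat.card (Subgroup.zpowers c) = l := by rw [Nat.card_zpowers, hc]
  have hfinC : Finite (Subgroup.zpowers c) := Nat.finite_of_card_ne_zero (hcard ▸ hl.ne_zero)
  have hntC : Nontrivial (Subgroup.zpowers c) := Subgroup.nontrivial_iff_ne_bot _ |>.2 fun h =>
    hc1 (Subgroup.zpowers_eq_bot.1 h)
  have ht : Function.Injective (π.comp t) := by
    have : Fact (Nat.card (Subgroup.zpowers c)).Prime := ⟨hcard ▸ hl⟩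
    rw [← MonoidHom.ker_eq_bot_iff]
    refine (Subgroup.eq_bot_or_eq_top_of_prime_card (π.comp t).ker).resolve_right fun h => hcU ?_
    have h1 : (⟨c, Subgroup.mem_zpowers c⟩ : Subgroup.zpowers c) ∈ (π.comp t).ker :=
      h ▸ Subgroup.mem_top _
    exact (QuotientGroup.eq_one_iff c).1 h1
  have hlp : l = p := by
    obtain ⟨m, hm⟩ := (hQ.of_injective _ ht) ⟨c, Subgroup.mem_zpowers c⟩
    have h1 : c ^ p ^ m = 1 := congrArg Subtype.val hm
    rw [← orderOf_dvd_iff_pow_eq_one, hc] at h1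
    exact (Nat.prime_dvd_prime_iff_eq hl Fact.out).1 (hl.dvd_of_dvd_pow h1)
  obtain ⟨d, hd⟩ := exists_forall_cocycles_le_coboundaries hp hfg hq
  obtain ⟨f, hf, hf'⟩ := TrivCoh.exists_cocycle_of_isCyclic (k := ZMod p)
    (C := Subgroup.zpowers c) (by rw [hcard, hlp, ZMod.natCast_self]) d
  -- The degree `2 d + 2` is even and exceeds `d`, so the cohomology of `G` vanishes there while
  -- that of the cyclic group does not.
  obtain ⟨h, hfh⟩ := TrivCoh.exists_eq_funD_of_injective hQ hπ t ht (hd (2 * d + 1 + 1) (by omega))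
    f hf
  exact hf' h hfh

theorem propositionA (p : ℕ) [Fact p.Prime] (G : Type*) [Group G] [TopologicalSpace G]
    [IsTopologicalGroup G] (hG : IsProP p G) (hfg : IsTopFinGen G) :
    (Odd p → IsHQuadratic p G → ∀ g : G, IsOfFinOrder g → g = 1) ∧
    (p = 2 → Finite G → (∀ a b : G, a * b = b * a) →
      (IsHQuadratic 2 G ↔ IsElementaryAbelian 2 G)) ∧
    (p = 2 → Finite G →
      ((∀ K : Subgroup G, IsHQuadratic 2 K) ↔ IsElementaryAbelian 2 G)) := by
  have := hG.t2
  have h2 : p = 2 → Finite G → IsPGroup 2 G := by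
    rintro rfl _
    -- A finite Hausdorff group is discrete, so the trivial subgroup is open.
    have h := hG.isPGroup ⊥ (isOpen_discrete _)
    exact h.of_equiv QuotientGroup.quotientBot
  refine ⟨fun hp hq => eq_one_of_isOfFinOrder_of_isHQuadratic hp hG hfg hq,
    fun hp _ hcomm => ⟨isElementaryAbelian_of_isHQuadratic G (h2 hp ‹_›) hcomm,
      isHQuadratic_of_isElementaryAbelian G⟩, fun hp _ => ⟨fun hq => ?_, fun hG K => ?_⟩⟩
  -- Cyclic subgroups are abelian, so the abelian case gives `g ^ 2 = 1` for every `g`, and a group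
  -- of exponent two is commutative.
  · have hzc : ∀ {g : G} (a b : Subgroup.zpowers g), a * b = b * a := by
      rintro g ⟨_, m, rfl⟩ ⟨_, n, rfl⟩
      exact Subtype.ext (zpow_mul_comm g m n)
    have hsq : ∀ g : G, g ^ 2 = 1 := fun g =>
      congrArg Subtype.val ((isElementaryAbelian_of_isHQuadratic (Subgroup.zpowers g)
        ((h2 hp ‹_›).to_subgroup _) hzc (hq _)).2 ⟨g, Subgroup.mem_zpowers g⟩)
    exact ⟨fun a b => Commute.of_orderOf_dvd_two (fun g => orderOf_dvd_of_pow_eq_one (hsq g)) a b, hsq⟩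
  · exact isHQuadratic_of_isElementaryAbelian K
      ⟨fun a b => Subtype.ext (hG.1 _ _), fun a => Subtype.ext (hG.2 _)⟩
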